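/- Let $p,k$ be natural numbers, $\lambda_1,\lambda_2>0$, and let $\mathcal G$ be a finite set of groups $g\subseteq\{1,\dots,p\}$. For $s\in\mathbb R^p$ let $s_{|g}$ be the vector that agrees with $s$ on $g$ and is zero elsewhere, and put $\|s\|_{\ell_1/\ell_\infty}=\sum_{g\in\mathcal G}\|s_{|g}\|_\infty$. For $d,s\in\mathbb R^p$, $L\in\mathbb R^{p\times k}$, $r\in\mathbb R^k$ define $$\hat\ell(d,L,r,s)=\tfrac12\|d-Lr-s\|_2^2+\tfrac{\lambda_1}{2}\|r\|_2^2+\lambda_2\|s\|_{\ell_1/\ell_\infty},\qquad \ell(d,L)=\min_{r,s}\hat\ell(d,L,r,s).$$ Let $d_1,d_2,\dots$ be independent, identically distributed, uniformly bounded random vectors in $\mathbb R^p$ (the frames), and let $L_0$ be a random $p\times k$ matrix independent of $(d_t)_{t\ge1}$ (in particular $L_0$ may be deterministic). Let $(r_t,s_t,L_t)_{t\ge 1}$ be the O-LSD iterates: for every $t\ge1$, $$(r_t,s_t)\in\arg\min_{r,s}\hat\ell(d_t,L_{t-1},r,s),\qquad L_t\in\arg\min_{L\in\mathbb R^{p\times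 k}} g_t(L),$$ where the surrogate function $g_t$ and the empirical cost function $f_t$ are $$g_t(L)=\frac1t\sum_{i=1}^t\hat\ell(d_i,L,r_i,s_i)+\frac{\lambda_1}{2t}\|L\|_F^2,\qquad f_t(L)=\frac1t\sum_{i=1}^t\ell(d_i,L)+\frac{\lambda_1}{2t}\|L\|_F^2 .$$ Then, almost surely, $g_t(L_t)-f_t(L_t)\to0$ as $t\to\infty$. -/

import Mathlib

open MeasureTheory ProbabilityTheory Filter Topology
open scoped Matrix

noncomputable section

/-- The structured sparsity norm `‖s‖_{ℓ₁/ℓ_∞} = ∑_{g ∈ 𝒢} ‖s_{|g}‖_∞`, where `s_{|g}` agrees with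
`s` on the group `g` and vanishes elsewhere (the norm on `Fin p → ℝ` is the sup norm). -/
def groupNorm {p : ℕ} (𝒢 : Finset (Finset (Fin p))) (s : EuclideanSpace ℝ (Fin p)) : ℝ :=
  ∑ g ∈ 𝒢, ‖(fun j : Fin p => if j ∈ g then s j else 0)‖

/-- The squared Frobenius norm of a matrix. -/
def frobSq {p k : ℕ} (L : Matrix (Fin p) (Fin k) ℝ) : ℝ :=
  ∑ i, ∑ j, L i j ^ 2

/-- The per-frame objective
`½ ‖d - L r - s‖₂² + (lam1 / 2) ‖r‖₂² + lam2 ‖s‖_{ℓ₁/ℓ_∞}`. -/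
def frameObj {p k : ℕ} (lam1 lam2 : ℝ) (𝒢 : Finset (Finset (Fin p)))
    (d : EuclideanSpace ℝ (Fin p)) (L : Matrix (Fin p) (Fin k) ℝ)
    (r : EuclideanSpace ℝ (Fin k)) (s : EuclideanSpace ℝ (Fin p)) : ℝ :=
  1 / 2 * ‖d - WithLp.toLp 2 (L *ᵥ r.ofLp) - s‖ ^ 2 + lam1 / 2 * ‖r‖ ^ 2
    + lam2 * groupNorm 𝒢 s

/-- The reconstruction cost `ℓ(d, L)`, the minimum of the per-frame objective over `(r, s)`. (For
positive weights the objective is nonnegative, continuous and coercive, so that the infimum is a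
minimum.) -/
def reconCost {p k : ℕ} (lam1 lam2 : ℝ) (𝒢 : Finset (Finset (Fin p)))
    (d : EuclideanSpace ℝ (Fin p)) (L : Matrix (Fin p) (Fin k) ℝ) : ℝ :=
  ⨅ x : EuclideanSpace ℝ (Fin k) × EuclideanSpace ℝ (Fin p), frameObj lam1 lam2 𝒢 d L x.1 x.2

/-- The empirical cost `f_t` of the first `t` frames `d 0, …, d (t - 1)`. -/
def empiricalCost {p k : ℕ} (lam1 lam2 : ℝ) (𝒢 : Finset (Finset (Fin p)))
    (d : ℕ → EuclideanSpace ℝ (Fin p)) (t : ℕ) (L : Matrix (Fin p) (Fin k) ℝ) : ℝ :=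
  1 / (t : ℝ) * ∑ i ∈ Finset.range t, reconCost lam1 lam2 𝒢 (d i) L
    + lam1 / (2 * (t : ℝ)) * frobSq L

/-- The surrogate `g_t` built from the first `t` frames and the pairs `(r i, s i)` computed for
them. -/
def surrogateCost {p k : ℕ} (lam1 lam2 : ℝ) (𝒢 : Finset (Finset (Fin p)))
    (d : ℕ → EuclideanSpace ℝ (Fin p)) (r : ℕ → EuclideanSpace ℝ (Fin k))
    (s : ℕ → EuclideanSpace ℝ (Fin p)) (t : ℕ) (L : Matrix (Fin p) (Fin k) ℝ) : ℝ :=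
  1 / (t : ℝ) * ∑ i ∈ Finset.range t, frameObj lam1 lam2 𝒢 (d i) L (r i) (s i)
    + lam1 / (2 * (t : ℝ)) * frobSq L

/-- A run of O-LSD on the frames `d 0, d 1, …` from the initial basis `L 0`. Frames are numbered
from `0`: the frame `d t` is the `(t + 1)`-st one, it is processed with the current basis `L t`, and
`L (t + 1)` is the basis after `t + 1` frames. -/
structure IsOLSDRun {p k : ℕ} (lam1 lam2 : ℝ) (𝒢 : Finset (Finset (Fin p)))
    (d : ℕ → EuclideanSpace ℝ (Fin p)) (L : ℕ → Matrix (Fin p) (Fin k) ℝ)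
    (r : ℕ → EuclideanSpace ℝ (Fin k)) (s : ℕ → EuclideanSpace ℝ (Fin p)) : Prop where
  /-- Foreground and background separation: `(r t, s t)` minimizes the per-frame objective. -/
  separation : ∀ (t : ℕ) (r' : EuclideanSpace ℝ (Fin k)) (s' : EuclideanSpace ℝ (Fin p)),
    frameObj lam1 lam2 𝒢 (d t) (L t) (r t) (s t) ≤ frameObj lam1 lam2 𝒢 (d t) (L t) r' s'
  /-- Subspace basis update: `L (t + 1)` minimizes the surrogate of the first `t + 1` frames. -/
  basis_update : ∀ (t : ℕ) (L' : Matrix (Fin p) (Fin k) ℝ),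
    surrogateCost lam1 lam2 𝒢 d r s (t + 1) (L (t + 1))
      ≤ surrogateCost lam1 lam2 𝒢 d r s (t + 1) L'

end

/-! ### The per-frame problem: existence, uniqueness, a priori bounds, and regularity of its value.
-/

section PerFrame

variable {p k : ℕ} {lam1 lam2 : ℝ} {𝒢 : Finset (Finset (Fin p))}

/-! Write ℓ(x, L) for the reconstruction cost, E ℓ(·) for its mean under the law of a frame, and let
bases be numbered from 0 as in the code. The gap is nonnegative because every stored pair is only a
competitor for the current basis. Since each new basis beats its predecessor on the same regularized
sum, the accumulated surrogate is at most λ₁/2 ‖L 0‖² + ∑_{i<t} ℓ(d i, L i). So the gap is at most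
O(1/t) plus the average of ℓ(d i, L i) minus the average of ℓ(d i, L t) (`IsOLSDRun.gap_bounds`).

A martingale law of large numbers replaces the first average by that of E ℓ(L i), because L i
depends only on the past of d i. A law of large numbers uniform in L replaces the second by E ℓ(L
t). If E ℓ(L t) converges almost surely, its Cesàro means have the same limit and the bound tends to
0. Neither boundedness of the bases nor a rate for their increments is needed.

The heart is that convergence (`ae_exists_tendsto_expectedCost`). With P the inverse of λ₁ I + ∑ r
rᵀ, e = d - L r - s the new residual, q = P r and a = 1 + r·q, the update is recursive least
squares: L moves by e qᵀ / a. Keeping an old separation as competitor bounds ℓ(x, ·) above by a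
quadratic expansion, with negative gradient Γ = e rᵀ. To first order the expected cost falls by ⟨E
Γ, Γ P⟩, whose conditional mean ⟨E Γ, (E Γ) P⟩ is nonnegative as P is positive semidefinite. All
remaining terms are bounded by a constant c times |q|²/a, which by Sherman–Morrison is exactly the
drop of tr P. Hence E ℓ(L t) + c tr P is a bounded nonnegative supermartingale; tr P is monotone, so
both summands converge. -/

theorem groupNorm_nonneg (𝒢 : Finset (Finset (Fin p))) (s : EuclideanSpace ℝ (Fin p)) :
    0 ≤ groupNorm 𝒢 s :=
  Finset.sum_nonneg fun _ _ => norm_nonneg _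

theorem groupNorm_zero (𝒢 : Finset (Finset (Fin p))) : groupNorm 𝒢 0 = 0 := by
  refine Finset.sum_eq_zero fun g _ => ?_
  rw [norm_eq_zero]
  funext j
  simp

theorem continuous_groupNorm (𝒢 : Finset (Finset (Fin p))) : Continuous (groupNorm 𝒢) := by
  unfold groupNorm
  refine continuous_finsetSum _ fun g _ => continuous_norm.comp ?_
  refine continuous_pi fun j => ?_
  by_cases h : j ∈ g
  · simp only [h, if_true]; fun_prop
  · simp only [h, if_false]; fun_prop

theorem groupNorm_midpoint_le (𝒢 : Finset (Finset (Fin p))) (s s' : EuclideanSpace ℝ (Fin p)) :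
    groupNorm 𝒢 ((1 / 2 : ℝ) • (s + s')) ≤ 1 / 2 * (groupNorm 𝒢 s + groupNorm 𝒢 s') := by
  unfold groupNorm
  rw [← Finset.sum_add_distrib, Finset.mul_sum]
  refine Finset.sum_le_sum fun g _ => ?_
  have h : (fun j : Fin p => if j ∈ g then ((1 / 2 : ℝ) • (s + s')) j else 0)
      = (1 / 2 : ℝ) • ((fun j : Fin p => if j ∈ g then s j else 0)
        + fun j : Fin p => if j ∈ g then s' j else 0) := by
    funext j
    by_cases h : j ∈ g <;> simp [h, mul_add]
  rw [h, norm_smul, Real.norm_of_nonneg (by norm_num : (0 : ℝ) ≤ 1 / 2)]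
  exact mul_le_mul_of_nonneg_left (norm_add_le _ _) (by norm_num)

theorem frobSq_nonneg (L : Matrix (Fin p) (Fin k) ℝ) : 0 ≤ frobSq L :=
  Finset.sum_nonneg fun _ _ => Finset.sum_nonneg fun _ _ => sq_nonneg _

theorem continuous_frobSq : Continuous (frobSq : Matrix (Fin p) (Fin k) ℝ → ℝ) := by
  unfold frobSq
  exact continuous_finsetSum _ fun i _ => continuous_finsetSum _ fun j _ =>
    (continuous_id.matrix_elem i j).pow 2

theorem norm_mulVec_sq_le (D : Matrix (Fin p) (Fin k) ℝ) (r : EuclideanSpace ℝ (Fin k)) :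
    ‖WithLp.toLp 2 (D *ᵥ r.ofLp)‖ ^ 2 ≤ ‖r‖ ^ 2 * frobSq D := by
  rw [EuclideanSpace.real_norm_sq_eq, EuclideanSpace.real_norm_sq_eq, frobSq, Finset.mul_sum]
  refine Finset.sum_le_sum fun i _ => ?_
  rw [mul_comm]
  exact Finset.sum_mul_sq_le_sq_mul_sq Finset.univ (fun j => D i j) (fun j => r.ofLp j)

/-- The residual `d - L r - s`. -/
noncomputable def frameResidual (d : EuclideanSpace ℝ (Fin p)) (L : Matrix (Fin p) (Fin k) ℝ)
    (r : EuclideanSpace ℝ (Fin k)) (s : EuclideanSpace ℝ (Fin p)) : EuclideanSpace ℝ (Fin p) :=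
  d - WithLp.toLp 2 (L *ᵥ r.ofLp) - s

theorem frameObj_eq_frameResidual (d : EuclideanSpace ℝ (Fin p)) (L : Matrix (Fin p) (Fin k) ℝ)
    (r : EuclideanSpace ℝ (Fin k)) (s : EuclideanSpace ℝ (Fin p)) :
    frameObj lam1 lam2 𝒢 d L r s
      = 1 / 2 * ‖frameResidual d L r s‖ ^ 2 + lam1 / 2 * ‖r‖ ^ 2 + lam2 * groupNorm 𝒢 s := rfl

theorem continuous_frameResidual :
    Continuous fun z : (EuclideanSpace ℝ (Fin p) × Matrix (Fin p) (Fin k) ℝ) ×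
      (EuclideanSpace ℝ (Fin k) × EuclideanSpace ℝ (Fin p)) =>
        frameResidual z.1.1 z.1.2 z.2.1 z.2.2 := by
  unfold frameResidual
  have h : Continuous fun z : (EuclideanSpace ℝ (Fin p) × Matrix (Fin p) (Fin k) ℝ) ×
      (EuclideanSpace ℝ (Fin k) × EuclideanSpace ℝ (Fin p)) => z.1.2 *ᵥ z.2.1.ofLp :=
    (continuous_snd.comp continuous_fst).matrix_mulVec (by fun_prop)
  fun_prop

theorem continuous_frameObj (lam1 lam2 : ℝ) (𝒢 : Finset (Finset (Fin p))) :
    Continuous fun z : (EuclideanSpace ℝ (Fin p) × Matrix (Fin p) (Fin k) ℝ) ×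
      (EuclideanSpace ℝ (Fin k) × EuclideanSpace ℝ (Fin p)) =>
        frameObj lam1 lam2 𝒢 z.1.1 z.1.2 z.2.1 z.2.2 := by
  simp only [frameObj_eq_frameResidual]
  have h1 := continuous_frameResidual (p := p) (k := k)
  have h2 := continuous_groupNorm 𝒢
  fun_prop

theorem continuous_frameObj_right (lam1 lam2 : ℝ) (𝒢 : Finset (Finset (Fin p)))
    (d : EuclideanSpace ℝ (Fin p)) (L : Matrix (Fin p) (Fin k) ℝ) :
    Continuous fun y : EuclideanSpace ℝ (Fin k) × EuclideanSpace ℝ (Fin p) =>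
      frameObj lam1 lam2 𝒢 d L y.1 y.2 := by
  have h := (continuous_frameObj (k := k) lam1 lam2 𝒢).comp (Continuous.prodMk_right (d, L))
  simpa only [Function.comp_def] using h

theorem frameObj_zero (d : EuclideanSpace ℝ (Fin p)) (L : Matrix (Fin p) (Fin k) ℝ) :
    frameObj lam1 lam2 𝒢 d L 0 0 = 1 / 2 * ‖d‖ ^ 2 := by
  simp [frameObj, groupNorm_zero]

theorem frameObj_add_frame (d c : EuclideanSpace ℝ (Fin p)) (L : Matrix (Fin p) (Fin k) ℝ)
    (r : EuclideanSpace ℝ (Fin k)) (s : EuclideanSpace ℝ (Fin p)) :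
    frameObj lam1 lam2 𝒢 (d + c) L r s = frameObj lam1 lam2 𝒢 d L r s
      + inner ℝ (frameResidual d L r s) c + 1 / 2 * ‖c‖ ^ 2 := by
  have h : frameResidual (d + c) L r s = frameResidual d L r s + c := by unfold frameResidual; abel
  rw [frameObj_eq_frameResidual, frameObj_eq_frameResidual, h, norm_add_sq_real]
  ring

theorem frameObj_add_basis (d : EuclideanSpace ℝ (Fin p)) (L D : Matrix (Fin p) (Fin k) ℝ)
    (r : EuclideanSpace ℝ (Fin k)) (s : EuclideanSpace ℝ (Fin p)) :
    frameObj lam1 lam2 𝒢 d (L + D) r s = frameObj lam1 lam2 𝒢 d L r s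
      - inner ℝ (frameResidual d L r s) (WithLp.toLp 2 (D *ᵥ r.ofLp))
      + 1 / 2 * ‖WithLp.toLp 2 (D *ᵥ r.ofLp)‖ ^ 2 := by
  have h : frameResidual d (L + D) r s = frameResidual d L r s - WithLp.toLp 2 (D *ᵥ r.ofLp) := by
    unfold frameResidual
    rw [Matrix.add_mulVec, WithLp.toLp_add]
    abel
  rw [frameObj_eq_frameResidual, frameObj_eq_frameResidual, h, norm_sub_sq_real]
  ring


theorem frameObj_nonneg (hlam1 : 0 < lam1) (hlam2 : 0 < lam2) (d : EuclideanSpace ℝ (Fin p))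
    (L : Matrix (Fin p) (Fin k) ℝ) (r : EuclideanSpace ℝ (Fin k)) (s : EuclideanSpace ℝ (Fin p)) :
    0 ≤ frameObj lam1 lam2 𝒢 d L r s := by
  rw [frameObj_eq_frameResidual]
  have := groupNorm_nonneg 𝒢 s
  positivity

theorem bddBelow_frameObj (hlam1 : 0 < lam1) (hlam2 : 0 < lam2) (d : EuclideanSpace ℝ (Fin p))
    (L : Matrix (Fin p) (Fin k) ℝ) :
    BddBelow (Set.range fun x : EuclideanSpace ℝ (Fin k) × EuclideanSpace ℝ (Fin p) =>
      frameObj lam1 lam2 𝒢 d L x.1 x.2) := by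
  refine ⟨0, ?_⟩
  rintro _ ⟨x, rfl⟩
  exact frameObj_nonneg hlam1 hlam2 _ _ _ _

theorem reconCost_le_frameObj (hlam1 : 0 < lam1) (hlam2 : 0 < lam2)
    (d : EuclideanSpace ℝ (Fin p)) (L : Matrix (Fin p) (Fin k) ℝ)
    (r : EuclideanSpace ℝ (Fin k)) (s : EuclideanSpace ℝ (Fin p)) :
    reconCost lam1 lam2 𝒢 d L ≤ frameObj lam1 lam2 𝒢 d L r s :=
  ciInf_le (bddBelow_frameObj hlam1 hlam2 d L) (r, s)

/-- `(r, s)` separates the frame `d` with respect to the basis `L`, that is, it minimizes the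
per-frame objective. -/
def IsSeparation (lam1 lam2 : ℝ) (𝒢 : Finset (Finset (Fin p))) (d : EuclideanSpace ℝ (Fin p))
    (L : Matrix (Fin p) (Fin k) ℝ) (r : EuclideanSpace ℝ (Fin k))
    (s : EuclideanSpace ℝ (Fin p)) : Prop :=
  ∀ r' s', frameObj lam1 lam2 𝒢 d L r s ≤ frameObj lam1 lam2 𝒢 d L r' s'

section IsSeparation

variable {d : EuclideanSpace ℝ (Fin p)} {L : Matrix (Fin p) (Fin k) ℝ}
  {r r' : EuclideanSpace ℝ (Fin k)} {s s' : EuclideanSpace ℝ (Fin p)}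

theorem IsSeparation.reconCost_eq (hlam1 : 0 < lam1) (hlam2 : 0 < lam2)
    (h : IsSeparation lam1 lam2 𝒢 d L r s) :
    reconCost lam1 lam2 𝒢 d L = frameObj lam1 lam2 𝒢 d L r s :=
  le_antisymm (reconCost_le_frameObj hlam1 hlam2 _ _ _ _) (le_ciInf fun x => h x.1 x.2)

/-- Comparison with the competitor (0, 0). This gives bounds on the residual and the coefficients
that do not depend on L, which is why the bases never have to be bounded. -/
theorem IsSeparation.bounds (hlam2 : 0 < lam2) (h : IsSeparation lam1 lam2 𝒢 d L r s) :
    ‖frameResidual d L r s‖ ^ 2 + lam1 * ‖r‖ ^ 2 ≤ ‖d‖ ^ 2 := by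
  have h0 := h 0 0
  rw [frameObj_zero, frameObj_eq_frameResidual] at h0
  have := mul_nonneg hlam2.le (groupNorm_nonneg 𝒢 s)
  linarith

theorem IsSeparation.norm_frameResidual_le (hlam1 : 0 < lam1) (hlam2 : 0 < lam2)
    (h : IsSeparation lam1 lam2 𝒢 d L r s) : ‖frameResidual d L r s‖ ≤ ‖d‖ := by
  have h0 := h.bounds hlam2
  have : 0 ≤ lam1 * ‖r‖ ^ 2 := by positivity
  exact (sq_le_sq₀ (norm_nonneg _) (norm_nonneg _)).1 (by linarith)

theorem IsSeparation.norm_sq_le (hlam1 : 0 < lam1) (hlam2 : 0 < lam2)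
    (h : IsSeparation lam1 lam2 𝒢 d L r s) : ‖r‖ ^ 2 ≤ ‖d‖ ^ 2 / lam1 := by
  have h0 := h.bounds hlam2
  rw [le_div_iff₀ hlam1]
  nlinarith [sq_nonneg ‖frameResidual d L r s‖]

/-- The objective is strictly convex in the residual and r, which together determine s. A midpoint
comparison with the parallelogram law forces both to agree; the group norm only needs midpoint
convexity. -/
theorem IsSeparation.unique (hlam1 : 0 < lam1) (hlam2 : 0 < lam2)
    (h : IsSeparation lam1 lam2 𝒢 d L r s) (h' : IsSeparation lam1 lam2 𝒢 d L r' s') :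
    r = r' ∧ s = s' := by
  have hv : frameObj lam1 lam2 𝒢 d L r s = frameObj lam1 lam2 𝒢 d L r' s' :=
    le_antisymm (h _ _) (h' _ _)
  have hm := h ((1 / 2 : ℝ) • (r + r')) ((1 / 2 : ℝ) • (s + s'))
  have he : frameResidual d L ((1 / 2 : ℝ) • (r + r')) ((1 / 2 : ℝ) • (s + s'))
      = (1 / 2 : ℝ) • (frameResidual d L r s + frameResidual d L r' s') := by
    unfold frameResidual
    rw [WithLp.ofLp_smul, WithLp.ofLp_add, Matrix.mulVec_smul, Matrix.mulVec_add, WithLp.toLp_smul,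
      WithLp.toLp_add]
    module
  simp only [frameObj_eq_frameResidual] at hv hm
  rw [he, norm_smul, norm_smul, Real.norm_of_nonneg (by norm_num : (0 : ℝ) ≤ 1 / 2)] at hm
  have hg := mul_le_mul_of_nonneg_left (groupNorm_midpoint_le 𝒢 s s') hlam2.le
  have pe := parallelogram_law_with_norm ℝ (frameResidual d L r s) (frameResidual d L r' s')
  have pr := parallelogram_law_with_norm ℝ r r'
  have hsum : ‖frameResidual d L r s - frameResidual d L r' s'‖ ^ 2
      + lam1 * ‖r - r'‖ ^ 2 ≤ 0 := by
    have pr' := congrArg (lam1 * ·) pr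
    ring_nf at pr' hm pe ⊢
    nlinarith
  have h1 : 0 ≤ lam1 * ‖r - r'‖ ^ 2 := by positivity
  have h2 : ‖r - r'‖ ^ 2 = 0 := by
    have : lam1 * ‖r - r'‖ ^ 2 = 0 :=
      le_antisymm (by linarith [sq_nonneg ‖frameResidual d L r s - frameResidual d L r' s'‖]) h1
    exact (mul_eq_zero.1 this).resolve_left hlam1.ne'
  have hr : r = r' := by simpa [sub_eq_zero] using h2
  have h3 : ‖frameResidual d L r s - frameResidual d L r' s'‖ ^ 2 = 0 :=
    le_antisymm (by linarith) (sq_nonneg _)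
  refine ⟨hr, ?_⟩
  have h4 : frameResidual d L r s = frameResidual d L r' s' := by simpa [sub_eq_zero] using h3
  subst hr
  simpa [frameResidual] using h4

end IsSeparation

/-- Replacing s by the residual is a continuous involution `S` for fixed d and L. In the new
coordinates every point beating (0, 0) lies in an explicit product of balls, so compactness applies
even when the groups do not cover all coordinates. -/
theorem exists_isSeparation (hlam1 : 0 < lam1) (hlam2 : 0 < lam2) (𝒢 : Finset (Finset (Fin p)))
    (d : EuclideanSpace ℝ (Fin p)) (L : Matrix (Fin p) (Fin k) ℝ) :
    ∃ x : EuclideanSpace ℝ (Fin k) × EuclideanSpace ℝ (Fin p),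
      IsSeparation lam1 lam2 𝒢 d L x.1 x.2 := by
  let S : EuclideanSpace ℝ (Fin k) × EuclideanSpace ℝ (Fin p) →
      EuclideanSpace ℝ (Fin k) × EuclideanSpace ℝ (Fin p) :=
    fun y => (y.1, frameResidual d L y.1 y.2)
  have hSS : ∀ y, S (S y) = y := fun y => by
    refine Prod.ext rfl ?_
    simp [S, frameResidual]
  have hS : Continuous S := continuous_fst.prodMk
    (continuous_frameResidual.comp (Continuous.prodMk_right (d, L)))
  have hF : Continuous fun y : EuclideanSpace ℝ (Fin k) × EuclideanSpace ℝ (Fin p) =>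
      frameObj lam1 lam2 𝒢 d L (S y).1 (S y).2 :=
    (continuous_frameObj_right lam1 lam2 𝒢 d L).comp hS
  let K : Set (EuclideanSpace ℝ (Fin k) × EuclideanSpace ℝ (Fin p)) :=
    Metric.closedBall 0 (Real.sqrt (‖d‖ ^ 2 / lam1)) ×ˢ Metric.closedBall 0 ‖d‖
  have hK : IsCompact K := (isCompact_closedBall _ _).prod (isCompact_closedBall _ _)
  have h0K : S (0, 0) ∈ K := by
    simp [S, K, frameResidual]
    positivity
  obtain ⟨y, -, hy⟩ := hK.exists_isMinOn ⟨_, h0K⟩ hF.continuousOn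
  have hy0 : frameObj lam1 lam2 𝒢 d L (S y).1 (S y).2 ≤ frameObj lam1 lam2 𝒢 d L 0 0 := by
    have := hy h0K
    simpa only [Set.mem_ofPred_eq, hSS] using this
  refine ⟨S y, fun r' s' => ?_⟩
  by_cases hin : S (r', s') ∈ K
  · have := hy hin
    simpa only [Set.mem_ofPred_eq, hSS] using this
  · refine hy0.trans ?_
    by_contra! hlt
    apply hin
    rw [frameObj_zero, frameObj_eq_frameResidual] at hlt
    have hg := mul_nonneg hlam2.le (groupNorm_nonneg 𝒢 s')
    have hr : 0 ≤ lam1 * ‖r'‖ ^ 2 := by positivity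
    refine ⟨?_, ?_⟩
    · rw [mem_closedBall_zero_iff]
      refine Real.le_sqrt_of_sq_le ?_
      rw [le_div_iff₀ hlam1]
      nlinarith [sq_nonneg ‖frameResidual d L r' s'‖]
    · rw [mem_closedBall_zero_iff]
      exact (sq_le_sq₀ (norm_nonneg _) (norm_nonneg _)).1
        (by change ‖frameResidual d L r' s'‖ ^ 2 ≤ ‖d‖ ^ 2; linarith)

theorem reconCost_nonneg (hlam1 : 0 < lam1) (hlam2 : 0 < lam2)
    (d : EuclideanSpace ℝ (Fin p)) (L : Matrix (Fin p) (Fin k) ℝ) :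
    0 ≤ reconCost lam1 lam2 𝒢 d L :=
  le_ciInf fun _ => frameObj_nonneg hlam1 hlam2 _ _ _ _

theorem reconCost_le (hlam1 : 0 < lam1) (hlam2 : 0 < lam2)
    (d : EuclideanSpace ℝ (Fin p)) (L : Matrix (Fin p) (Fin k) ℝ) :
    reconCost lam1 lam2 𝒢 d L ≤ 1 / 2 * ‖d‖ ^ 2 :=
  (reconCost_le_frameObj hlam1 hlam2 d L 0 0).trans_eq (frameObj_zero d L)

/-- The separation for L stays an admissible competitor for L + D. This one-sided quadratic bound
replaces differentiability of the reconstruction cost throughout. -/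
theorem IsSeparation.reconCost_add_basis_le {d : EuclideanSpace ℝ (Fin p)}
    {L : Matrix (Fin p) (Fin k) ℝ} {r : EuclideanSpace ℝ (Fin k)} {s : EuclideanSpace ℝ (Fin p)}
    (hlam1 : 0 < lam1) (hlam2 : 0 < lam2) (h : IsSeparation lam1 lam2 𝒢 d L r s)
    (D : Matrix (Fin p) (Fin k) ℝ) :
    reconCost lam1 lam2 𝒢 d (L + D) ≤ reconCost lam1 lam2 𝒢 d L
      - inner ℝ (frameResidual d L r s) (WithLp.toLp 2 (D *ᵥ r.ofLp))
      + 1 / 2 * (‖r‖ ^ 2 * frobSq D) := by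
  have h1 := reconCost_le_frameObj (𝒢 := 𝒢) hlam1 hlam2 d (L + D) r s
  rw [frameObj_add_basis, ← h.reconCost_eq hlam1 hlam2] at h1
  linarith [norm_mulVec_sq_le D r]

/-- The bound is uniform in L: it makes x ↦ ℓ(x, ·) continuous for the supremum norm, as the uniform
law of large numbers requires. -/
theorem abs_reconCost_add_frame_sub_le (hlam1 : 0 < lam1) (hlam2 : 0 < lam2)
    (d c : EuclideanSpace ℝ (Fin p)) (L : Matrix (Fin p) (Fin k) ℝ) :
    |reconCost lam1 lam2 𝒢 (d + c) L - reconCost lam1 lam2 𝒢 d L|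
      ≤ (‖d‖ + 2 * ‖c‖) * ‖c‖ := by
  have key : ∀ d c : EuclideanSpace ℝ (Fin p), reconCost lam1 lam2 𝒢 (d + c) L
      ≤ reconCost lam1 lam2 𝒢 d L + (‖d‖ + ‖c‖) * ‖c‖ := fun d c => by
    obtain ⟨⟨r, s⟩, h⟩ := exists_isSeparation hlam1 hlam2 𝒢 d L
    have h1 := reconCost_le_frameObj (𝒢 := 𝒢) hlam1 hlam2 (d + c) L r s
    rw [frameObj_add_frame, ← h.reconCost_eq hlam1 hlam2] at h1
    have h2 := real_inner_le_norm (frameResidual d L r s) c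
    have h3 := mul_le_mul_of_nonneg_right (h.norm_frameResidual_le hlam1 hlam2) (norm_nonneg c)
    nlinarith [sq_nonneg ‖c‖]
  have h1 := key d c
  have h2 := key (d + c) (-c)
  rw [add_neg_cancel_right, norm_neg] at h2
  have h3 := mul_le_mul_of_nonneg_right (norm_add_le d c) (norm_nonneg c)
  rw [abs_le]
  constructor <;> nlinarith [sq_nonneg ‖c‖]

theorem abs_reconCost_sub_le (hlam1 : 0 < lam1) (hlam2 : 0 < lam2)
    (d : EuclideanSpace ℝ (Fin p)) (L L' : Matrix (Fin p) (Fin k) ℝ) :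
    |reconCost lam1 lam2 𝒢 d L' - reconCost lam1 lam2 𝒢 d L|
      ≤ (‖d‖ ^ 2 / lam1 + 1) * (frobSq (L' - L) + Real.sqrt (frobSq (L' - L)) * ‖d‖) := by
  have hρ : 0 ≤ ‖d‖ ^ 2 / lam1 := by positivity
  have key : ∀ L D : Matrix (Fin p) (Fin k) ℝ, reconCost lam1 lam2 𝒢 d (L + D)
      ≤ reconCost lam1 lam2 𝒢 d L
        + (‖d‖ ^ 2 / lam1 + 1) * (frobSq D + Real.sqrt (frobSq D) * ‖d‖) := fun L D => by
    obtain ⟨⟨r, s⟩, h⟩ := exists_isSeparation hlam1 hlam2 𝒢 d L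
    have h1 := h.reconCost_add_basis_le hlam1 hlam2 D
    have hr := h.norm_sq_le hlam1 hlam2
    have hf := frobSq_nonneg D
    have h2 := neg_le_of_abs_le
      (abs_real_inner_le_norm (frameResidual d L r s) (WithLp.toLp 2 (D *ᵥ r.ofLp)))
    have h3 : ‖WithLp.toLp 2 (D *ᵥ r.ofLp)‖ ≤ (‖d‖ ^ 2 / lam1 + 1) * Real.sqrt (frobSq D) := by
      refine (Real.le_sqrt_of_sq_le (norm_mulVec_sq_le D r)).trans ?_
      rw [Real.sqrt_mul (sq_nonneg _), Real.sqrt_sq (norm_nonneg _)]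
      refine mul_le_mul_of_nonneg_right ?_ (Real.sqrt_nonneg _)
      -- From ‖r‖² ≤ ρ and (‖r‖ - 1)² ≥ 0 one gets ‖r‖ ≤ ρ + 1, which avoids a square root of ρ.
      simp only at hr
      nlinarith [sq_nonneg (‖r‖ - 1)]
    have h4 := mul_le_mul (h.norm_frameResidual_le hlam1 hlam2) h3 (norm_nonneg _) (norm_nonneg _)
    have h5 : ‖r‖ ^ 2 * frobSq D ≤ (‖d‖ ^ 2 / lam1) * frobSq D :=
      mul_le_mul_of_nonneg_right hr hf
    simp only at h1 h2 h4 h5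
    nlinarith [mul_nonneg hρ hf]
  have h1 := key L (L' - L)
  have h2 := key L' (L - L')
  have h3 : frobSq (L - L') = frobSq (L' - L) := by
    simp only [frobSq, Matrix.sub_apply]
    exact Finset.sum_congr rfl fun i _ => Finset.sum_congr rfl fun j _ => by ring
  rw [add_sub_cancel] at h1 h2
  rw [h3] at h2
  rw [abs_le]
  constructor <;> linarith

theorem continuous_reconCost_basis (hlam1 : 0 < lam1) (hlam2 : 0 < lam2)
    (𝒢 : Finset (Finset (Fin p))) (d : EuclideanSpace ℝ (Fin p)) :
    Continuous fun L : Matrix (Fin p) (Fin k) ℝ => reconCost lam1 lam2 𝒢 d L := by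
  refine continuous_iff_continuousAt.2 fun L => ?_
  refine tendsto_iff_dist_tendsto_zero.2 ?_
  have hc : Continuous fun L' : Matrix (Fin p) (Fin k) ℝ => (‖d‖ ^ 2 / lam1 + 1)
      * (frobSq (L' - L) + Real.sqrt (frobSq (L' - L)) * ‖d‖) := by
    have := continuous_frobSq.comp (continuous_id.sub (continuous_const (y := L)))
    exact continuous_const.mul (this.add ((Real.continuous_sqrt.comp this).mul continuous_const))
  refine squeeze_zero (fun _ => dist_nonneg) (fun L' => abs_reconCost_sub_le hlam1 hlam2 d L L') ?_
  have := hc.tendsto L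
  simpa [frobSq] using this

end PerFrame

/-! ### Measurability of unique minimizers and of matrix-valued maps. -/

section MeasurableMinimizer

/-- A unique minimizer of a Carathéodory integrand depends measurably on the parameter. -/
theorem measurable_of_unique_minimizer {X Y : Type*} [MeasurableSpace X] [MetricSpace Y]
    [ProperSpace Y] [MeasurableSpace Y] [BorelSpace Y] {F : X → Y → ℝ} {f : X → Y}
    (hFm : ∀ y, Measurable fun x => F x y) (hFc : ∀ x, Continuous (F x))
    (hmin : ∀ x y, F x (f x) ≤ F x y) (huniq : ∀ x y, (∀ y', F x y ≤ F x y') → y = f x) :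
    Measurable f := by
  have hcompact : ∀ K : Set Y, IsCompact K → MeasurableSet (f ⁻¹' K) := by
    intro K hK
    obtain ⟨D, hDc, hDd⟩ := TopologicalSpace.exists_countable_dense Y
    obtain ⟨C, hCc, hCd⟩ := TopologicalSpace.exists_countable_dense K
    -- The minimizer lies in K exactly when the infimum over K does not exceed the value at any
    -- point. Density in Y and in K makes this a countable condition.
    have hset : f ⁻¹' K = ⋂ y ∈ D, ⋂ n : ℕ, ⋃ q ∈ C,
        {x | F x (q : Y) < F x y + 1 / ((n : ℝ) + 1)} := by
      ext x
      simp only [Set.mem_preimage, Set.mem_iInter, Set.mem_iUnion, Set.mem_ofPred_eq, exists_prop]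
      constructor
      · intro hx y _ n
        have hopen : IsOpen {q : K | F x (q : Y) < F x y + 1 / ((n : ℝ) + 1)} :=
          isOpen_lt ((hFc x).comp continuous_subtype_val) continuous_const
        have hpos : (0 : ℝ) < 1 / ((n : ℝ) + 1) := by positivity
        obtain ⟨q, hq, hqC⟩ := hCd.inter_open_nonempty _ hopen
          ⟨⟨f x, hx⟩, by have := hmin x y; simp only [Set.mem_ofPred_eq]; linarith⟩
        exact ⟨q, hqC, hq⟩
      · intro hx
        have hDne : D.Nonempty := by
          have : Nonempty Y := ⟨f x⟩
          exact hDd.nonempty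
        obtain ⟨y₀, hy₀⟩ := hDne
        obtain ⟨q₀, -, -⟩ := hx y₀ hy₀ 0
        obtain ⟨z, hzK, hz⟩ := hK.exists_isMinOn ⟨q₀, q₀.2⟩ (hFc x).continuousOn
        have hzD : ∀ y ∈ D, F x z ≤ F x y := by
          intro y hy
          refine le_of_forall_pos_lt_add fun ε hε => ?_
          obtain ⟨n, hn⟩ := exists_nat_one_div_lt hε
          obtain ⟨q, -, hq⟩ := hx y hy n
          have : F x z ≤ F x q := hz q.2
          linarith
        have hzY : ∀ y, F x z ≤ F x y := by
          intro y
          have hcl : IsClosed {y | F x z ≤ F x y} := isClosed_le continuous_const (hFc x)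
          exact hcl.closure_subset_iff.2 hzD (hDd y)
        rw [← huniq x z hzY]
        exact hzK
    rw [hset]
    refine MeasurableSet.biInter hDc fun y _ => MeasurableSet.iInter fun n =>
      MeasurableSet.biUnion hCc fun q _ => ?_
    exact measurableSet_lt (hFm q) ((hFm y).add measurable_const)
  refine measurable_of_isClosed fun S hS => ?_
  rcases isEmpty_or_nonempty X with hX | ⟨⟨x₀⟩⟩
  · rw [Set.eq_empty_of_isEmpty (f ⁻¹' S)]
    exact MeasurableSet.empty
  have hunion : f ⁻¹' S = ⋃ n : ℕ, f ⁻¹' (S ∩ Metric.closedBall (f x₀) n) := by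
    rw [← Set.preimage_iUnion, ← Set.inter_iUnion, Metric.iUnion_closedBall_nat, Set.inter_univ]
  rw [hunion]
  exact MeasurableSet.iUnion fun n =>
    hcompact _ ((isCompact_closedBall _ _).inter_left hS)

instance Matrix.instMeasurableSpaceReal (m n : Type*) : MeasurableSpace (Matrix m n ℝ) :=
  MeasurableSpace.pi (X := fun _ : m => n → ℝ)

instance Matrix.instBorelSpaceReal (m n : Type*) [Finite m] [Finite n] :
    BorelSpace (Matrix m n ℝ) :=
  Pi.borelSpace (X := fun _ : m => n → ℝ)

theorem Matrix.measurable_entry {m n : Type*} (i : m) (j : n) :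
    Measurable fun A : Matrix m n ℝ => A i j :=
  (measurable_pi_apply (X := fun _ : n => ℝ) j).comp (measurable_pi_apply (X := fun _ : m => n → ℝ) i)

theorem Matrix.measurable_of_entries {m n X : Type*} [MeasurableSpace X] {f : X → Matrix m n ℝ}
    (h : ∀ i j, Measurable fun x => f x i j) : Measurable f :=
  measurable_pi_lambda (X := fun _ : m => n → ℝ) _ fun i => measurable_pi_lambda _ fun j => h i j

end MeasurableMinimizer

/-! ### Positivity, bounds and trace of the recursive least squares gain. -/

section Gain

variable {p k : ℕ}

/-- The inverses of the matrices `lam • 1 + ∑ i < t, r i (r i)ᵀ`, computed by the Sherman–Morrison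
recursion. -/
noncomputable def gain (lam : ℝ) (r : ℕ → Fin k → ℝ) : ℕ → Matrix (Fin k) (Fin k) ℝ
  | 0 => lam⁻¹ • 1
  | t + 1 => gain lam r t - (1 + r t ⬝ᵥ gain lam r t *ᵥ r t)⁻¹ •
      Matrix.vecMulVec (gain lam r t *ᵥ r t) (gain lam r t *ᵥ r t)

theorem gain_succ (lam : ℝ) (r : ℕ → Fin k → ℝ) (t : ℕ) :
    gain lam r (t + 1) = gain lam r t - (1 + r t ⬝ᵥ gain lam r t *ᵥ r t)⁻¹ •
      Matrix.vecMulVec (gain lam r t *ᵥ r t) (gain lam r t *ᵥ r t) := rfl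

theorem gain_isSymm (lam : ℝ) (r : ℕ → Fin k → ℝ) (t : ℕ) : (gain lam r t)ᵀ = gain lam r t := by
  induction t with
  | zero => simp [gain]
  | succ t ih => rw [gain_succ, Matrix.transpose_sub, Matrix.transpose_smul, ih,
      Matrix.transpose_vecMulVec]

/-- With A the Gram sum and y = P x, the form is (A y)·y. It is stated for any right inverse P
because the induction identifying `gain` needs positivity first, to keep the Sherman–Morrison
denominator away from zero. -/
theorem dotProduct_mulVec_nonneg_of_mul_eq_one {lam : ℝ} (hlam : 0 < lam) {r : ℕ → Fin k → ℝ}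
    {t : ℕ} {P : Matrix (Fin k) (Fin k) ℝ}
    (hP : (∑ i ∈ Finset.range t, Matrix.vecMulVec (r i) (r i) + lam • 1) * P = 1)
    (x : Fin k → ℝ) : 0 ≤ x ⬝ᵥ P *ᵥ x := by
  have hx : x = (∑ i ∈ Finset.range t, Matrix.vecMulVec (r i) (r i) + lam • 1) *ᵥ (P *ᵥ x) := by
    rw [Matrix.mulVec_mulVec, hP, Matrix.one_mulVec]
  nth_rewrite 1 [hx]
  rw [Matrix.add_mulVec, Matrix.sum_mulVec, add_dotProduct, sum_dotProduct]
  refine add_nonneg (Finset.sum_nonneg fun i _ => ?_) ?_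
  · rw [Matrix.vecMulVec_mulVec]
    simp only [op_smul_eq_smul, smul_dotProduct, smul_eq_mul]
    exact mul_self_nonneg _
  · simp only [Matrix.smul_mulVec, Matrix.one_mulVec, smul_dotProduct, smul_eq_mul]
    exact mul_nonneg hlam.le (Finset.sum_nonneg fun _ _ => mul_self_nonneg _)

theorem sum_vecMulVec_add_mul_gain {lam : ℝ} (hlam : 0 < lam) (r : ℕ → Fin k → ℝ) (t : ℕ) :
    (∑ i ∈ Finset.range t, Matrix.vecMulVec (r i) (r i) + lam • 1) * gain lam r t = 1 := by
  induction t with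
  | zero => simp [gain, hlam.ne']
  | succ t ih =>
    have ha : 0 < 1 + r t ⬝ᵥ gain lam r t *ᵥ r t := by
      linarith [dotProduct_mulVec_nonneg_of_mul_eq_one hlam ih (r t)]
    set P := gain lam r t with hP
    set q := P *ᵥ r t with hq
    set A := ∑ i ∈ Finset.range t, Matrix.vecMulVec (r i) (r i) + lam • 1 with hA
    have hqv : r t ᵥ* P = q := by
      rw [hq, ← Matrix.vecMul_transpose, hP, gain_isSymm]
    have hAq : A *ᵥ q = r t := by rw [hq, Matrix.mulVec_mulVec, ih, Matrix.one_mulVec]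
    have hAs : ∑ i ∈ Finset.range (t + 1), Matrix.vecMulVec (r i) (r i) + lam • 1
        = A + Matrix.vecMulVec (r t) (r t) := by
      rw [Finset.sum_range_succ, hA]; abel
    have hc : (1 + r t ⬝ᵥ q)⁻¹ * (r t ⬝ᵥ q) = 1 - (1 + r t ⬝ᵥ q)⁻¹ := by
      field_simp
      ring
    rw [hAs, gain_succ, ← hP, ← hq, add_mul, mul_sub, mul_sub, ih, Matrix.mul_smul,
      Matrix.mul_smul, Matrix.mul_vecMulVec, hAq, Matrix.vecMulVec_mul, hqv,
      Matrix.vecMulVec_mul_vecMulVec, Matrix.vecMulVec_smul, smul_smul, hc, sub_smul, one_smul]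
    abel

theorem dotProduct_gain_nonneg {lam : ℝ} (hlam : 0 < lam) (r : ℕ → Fin k → ℝ) (t : ℕ)
    (x : Fin k → ℝ) : 0 ≤ x ⬝ᵥ gain lam r t *ᵥ x :=
  dotProduct_mulVec_nonneg_of_mul_eq_one hlam (sum_vecMulVec_add_mul_gain hlam r t) x

theorem gain_succ_mulVec {lam : ℝ} (hlam : 0 < lam) (r : ℕ → Fin k → ℝ) (t : ℕ) :
    gain lam r (t + 1) *ᵥ r t
      = (1 + r t ⬝ᵥ gain lam r t *ᵥ r t)⁻¹ • gain lam r t *ᵥ r t := by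
  have ha : 0 < 1 + r t ⬝ᵥ gain lam r t *ᵥ r t := by
    linarith [dotProduct_gain_nonneg hlam r t (r t)]
  rw [gain_succ, Matrix.sub_mulVec, Matrix.smul_mulVec, Matrix.vecMulVec_mulVec]
  set q := gain lam r t *ᵥ r t
  simp only [op_smul_eq_smul]
  rw [dotProduct_comm q, smul_smul]
  have hc : (1 + r t ⬝ᵥ q)⁻¹ * (r t ⬝ᵥ q) = 1 - (1 + r t ⬝ᵥ q)⁻¹ := by
    field_simp
    ring
  rw [hc, sub_smul, one_smul]
  abel

theorem dotProduct_gain_le {lam : ℝ} (hlam : 0 < lam) (r : ℕ → Fin k → ℝ) (t : ℕ)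
    (x : Fin k → ℝ) : x ⬝ᵥ gain lam r t *ᵥ x ≤ lam⁻¹ * (x ⬝ᵥ x) := by
  induction t with
  | zero => simp [gain, Matrix.smul_mulVec]
  | succ t ih =>
    have ha : 0 < 1 + r t ⬝ᵥ gain lam r t *ᵥ r t := by
      linarith [dotProduct_gain_nonneg hlam r t (r t)]
    refine le_trans ?_ ih
    rw [gain_succ, Matrix.sub_mulVec, Matrix.smul_mulVec, Matrix.vecMulVec_mulVec, dotProduct_sub]
    set q := gain lam r t *ᵥ r t
    simp only [op_smul_eq_smul, dotProduct_smul, smul_eq_mul]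
    rw [dotProduct_comm q]
    have := mul_nonneg (inv_nonneg.2 ha.le) (mul_self_nonneg (x ⬝ᵥ q))
    linarith

/-- Polarization: positivity at e_i ± e_j gives |P i j| ≤ (P i i + P j j) / 2, and the diagonal is
at most 1/λ. -/
theorem abs_gain_apply_le {lam : ℝ} (hlam : 0 < lam) (r : ℕ → Fin k → ℝ) (t : ℕ) (i j : Fin k) :
    |gain lam r t i j| ≤ lam⁻¹ := by
  have hs : gain lam r t j i = gain lam r t i j := congrFun (congrFun (gain_isSymm lam r t) i) j
  have h1 := dotProduct_gain_nonneg hlam r t (Pi.single i 1 + Pi.single j 1)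
  have h2 := dotProduct_gain_nonneg hlam r t (Pi.single i 1 - Pi.single j 1)
  have h3 := dotProduct_gain_le hlam r t (Pi.single i 1)
  have h4 := dotProduct_gain_le hlam r t (Pi.single j 1)
  simp only [Matrix.mulVec_add, Matrix.mulVec_sub, add_dotProduct, sub_dotProduct, dotProduct_add,
    dotProduct_sub, Matrix.mulVec_single_one, single_one_dotProduct, Matrix.col_apply, hs,
    Pi.single_eq_same, mul_one] at h1 h2 h3 h4
  rw [abs_le]
  constructor <;> linarith

theorem trace_gain_nonneg {lam : ℝ} (hlam : 0 < lam) (r : ℕ → Fin k → ℝ) (t : ℕ) :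
    0 ≤ (gain lam r t).trace :=
  Finset.sum_nonneg fun i _ => by
    simpa [Matrix.mulVec_single_one, single_one_dotProduct] using
      dotProduct_gain_nonneg hlam r t (Pi.single i 1)

theorem trace_gain_le {lam : ℝ} (hlam : 0 < lam) (r : ℕ → Fin k → ℝ) (t : ℕ) :
    (gain lam r t).trace ≤ k * lam⁻¹ := by
  refine (Finset.sum_le_card_nsmul _ _ _ fun i _ =>
    (le_abs_self _).trans (abs_gain_apply_le hlam r t i i)).trans_eq ?_
  simp

/-- The drop of the trace is |q|²/a, precisely the size of the second-order error of one basis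
update. This makes those errors telescope. -/
theorem trace_gain_succ (lam : ℝ) (r : ℕ → Fin k → ℝ) (t : ℕ) :
    (gain lam r (t + 1)).trace = (gain lam r t).trace - (1 + r t ⬝ᵥ gain lam r t *ᵥ r t)⁻¹ *
      ((gain lam r t *ᵥ r t) ⬝ᵥ (gain lam r t *ᵥ r t)) := by
  rw [gain_succ, Matrix.trace_sub, Matrix.trace_smul, Matrix.trace_vecMulVec, smul_eq_mul]

end Gain

/-! ### Normal equations for the basis and their recursive form. -/

section BasisUpdate

variable {p k : ℕ} {lam1 lam2 : ℝ} {𝒢 : Finset (Finset (Fin p))}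

theorem frobSq_add_single (L : Matrix (Fin p) (Fin k) ℝ) (a : Fin p) (b : Fin k) (ε : ℝ) :
    frobSq (L + Matrix.single a b ε) = frobSq L + 2 * ε * L a b + ε ^ 2 := by
  have h : ∀ i j, (L + Matrix.single a b ε) i j ^ 2
      = L i j ^ 2 + if a = i then (if b = j then 2 * ε * L a b + ε ^ 2 else 0) else 0 := by
    intro i j
    by_cases hi : a = i
    · by_cases hj : b = j
      · subst hi hj; simp; ring
      · simp [hj]
    · simp [hi]
  simp only [frobSq, h, Finset.sum_add_distrib]
  simp
  ring

theorem eq_zero_of_forall_mul_le_sq {c K : ℝ} (h : ∀ ε : ℝ, ε * c ≤ K * ε ^ 2) : c = 0 := by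
  have hK : 0 ≤ |K| + 1 := by positivity
  -- A step small enough that the linear term is c²/(2(|K|+1)), twice the bound on the quadratic
  -- one; the +1 keeps the denominator positive.
  have h1 := h (c / (2 * (|K| + 1)))
  have hne : |K| + 1 ≠ 0 := by positivity
  have h2 : K * (c / (2 * (|K| + 1))) ^ 2 ≤ (|K| + 1) * (c / (2 * (|K| + 1))) ^ 2 :=
    mul_le_mul_of_nonneg_right (by linarith [le_abs_self K]) (sq_nonneg _)
  have h3 : (|K| + 1) * (c / (2 * (|K| + 1))) ^ 2 = c ^ 2 / (|K| + 1) / 4 := by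
    field_simp
    ring
  have h4 : c / (2 * (|K| + 1)) * c = c ^ 2 / (|K| + 1) / 2 := by
    field_simp
  have h5 : c ^ 2 / (|K| + 1) ≤ 0 := by linarith
  have h6 : c ^ 2 ≤ 0 := by
    by_contra! hc
    exact absurd (div_pos hc (by positivity : 0 < |K| + 1)) (not_lt.2 h5)
  exact pow_eq_zero_iff (by norm_num) |>.1 (le_antisymm h6 (sq_nonneg c))

/-- Stationarity of the surrogate, entry by entry: perturbing one entry by ε changes the objective
by a linear term and at most a multiple of ε², so the linear coefficient vanishes. -/
theorem sum_vecMulVec_frameResidual_eq {d : ℕ → EuclideanSpace ℝ (Fin p)}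
    {r : ℕ → EuclideanSpace ℝ (Fin k)} {s : ℕ → EuclideanSpace ℝ (Fin p)} {t : ℕ}
    (ht : 0 < t) {L : Matrix (Fin p) (Fin k) ℝ}
    (hmin : ∀ L', surrogateCost lam1 lam2 𝒢 d r s t L ≤ surrogateCost lam1 lam2 𝒢 d r s t L') :
    ∑ i ∈ Finset.range t, Matrix.vecMulVec (frameResidual (d i) L (r i) (s i)).ofLp (r i).ofLp
      = lam1 • L := by
  have htr : (0 : ℝ) < t := by exact_mod_cast ht
  ext a b
  rw [Matrix.sum_apply, Matrix.smul_apply, ← sub_eq_zero]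
  refine eq_zero_of_forall_mul_le_sq
    (K := 1 / 2 * (∑ i ∈ Finset.range t, ‖r i‖ ^ 2 + lam1)) fun ε => ?_
  have h := hmin (L + Matrix.single a b ε)
  have hmv : ∀ i, Matrix.single a b ε *ᵥ (r i).ofLp = Pi.single a (ε * (r i) b) := fun i => by
    ext j
    by_cases hj : a = j
    · subst hj; simp [Matrix.mulVec, dotProduct, Matrix.single_apply]
    · simp [Matrix.mulVec, dotProduct, hj, Ne.symm hj]
  have hin : ∀ i, inner ℝ (frameResidual (d i) L (r i) (s i))
      (WithLp.toLp 2 (Matrix.single a b ε *ᵥ (r i).ofLp))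
      = ε * Matrix.vecMulVec (frameResidual (d i) L (r i) (s i)).ofLp (r i).ofLp a b := fun i => by
    rw [hmv, EuclideanSpace.inner_eq_star_dotProduct]
    simp [Matrix.vecMulVec_apply]
    ring
  have hterm : ∀ i, frameObj lam1 lam2 𝒢 (d i) (L + Matrix.single a b ε) (r i) (s i)
      ≤ frameObj lam1 lam2 𝒢 (d i) L (r i) (s i)
        - ε * Matrix.vecMulVec (frameResidual (d i) L (r i) (s i)).ofLp (r i).ofLp a b
        + 1 / 2 * (‖r i‖ ^ 2 * ε ^ 2) := fun i => by
    have h1 := norm_mulVec_sq_le (Matrix.single a b ε) (r i)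
    have h2 := frobSq_add_single (0 : Matrix (Fin p) (Fin k) ℝ) a b ε
    have h3 : frobSq (0 : Matrix (Fin p) (Fin k) ℝ) = 0 := by simp [frobSq]
    rw [zero_add, h3, Matrix.zero_apply] at h2
    rw [frameObj_add_basis, hin]
    rw [h2] at h1
    linarith
  have hsum := Finset.sum_le_sum fun i (_ : i ∈ Finset.range t) => hterm i
  simp only [Finset.sum_add_distrib, Finset.sum_sub_distrib, ← Finset.mul_sum,
    ← Finset.sum_mul] at hsum
  unfold surrogateCost at h
  rw [frobSq_add_single] at h
  have hscale : ∀ x y : ℝ, 1 / (t : ℝ) * x + lam1 / (2 * t) * y = 1 / t * (x + lam1 / 2 * y) :=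
    fun x y => by field_simp
  rw [hscale, hscale] at h
  have h' := le_of_mul_le_mul_left h (by positivity : 0 < 1 / (t : ℝ))
  rw [smul_eq_mul]
  nlinarith

theorem basis_eq_mul_gain (hlam1 : 0 < lam1) {d : ℕ → EuclideanSpace ℝ (Fin p)}
    {r : ℕ → EuclideanSpace ℝ (Fin k)} {s : ℕ → EuclideanSpace ℝ (Fin p)} {t : ℕ}
    (ht : 0 < t) {L : Matrix (Fin p) (Fin k) ℝ}
    (hmin : ∀ L', surrogateCost lam1 lam2 𝒢 d r s t L ≤ surrogateCost lam1 lam2 𝒢 d r s t L') :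
    L = (∑ i ∈ Finset.range t, Matrix.vecMulVec (d i - s i).ofLp (r i).ofLp)
      * gain lam1 (fun i => (r i).ofLp) t := by
  have h := sum_vecMulVec_frameResidual_eq ht hmin
  have hterm : ∀ i, Matrix.vecMulVec (frameResidual (d i) L (r i) (s i)).ofLp (r i).ofLp
      = Matrix.vecMulVec (d i - s i).ofLp (r i).ofLp
        - L * Matrix.vecMulVec (r i).ofLp (r i).ofLp := fun i => by
    rw [Matrix.mul_vecMulVec, ← Matrix.sub_vecMulVec]
    congr 1
    simp only [frameResidual, WithLp.ofLp_sub]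
    abel
  simp only [hterm, Finset.sum_sub_distrib, ← Matrix.mul_sum] at h
  have h' : (∑ i ∈ Finset.range t, Matrix.vecMulVec (d i - s i).ofLp (r i).ofLp)
      = L * (∑ i ∈ Finset.range t, Matrix.vecMulVec (r i).ofLp (r i).ofLp + lam1 • 1) := by
    rw [Matrix.mul_add, Matrix.mul_smul, Matrix.mul_one, ← h]
    abel
  rw [h', Matrix.mul_assoc, sum_vecMulVec_add_mul_gain hlam1 fun i => (r i).ofLp, Matrix.mul_one]

/-- The basis update is a recursive least squares step. -/
theorem IsOLSDRun.basis_succ (hlam1 : 0 < lam1) {d : ℕ → EuclideanSpace ℝ (Fin p)}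
    {L : ℕ → Matrix (Fin p) (Fin k) ℝ} {r : ℕ → EuclideanSpace ℝ (Fin k)}
    {s : ℕ → EuclideanSpace ℝ (Fin p)} (h : IsOLSDRun lam1 lam2 𝒢 d L r s) {t : ℕ} (ht : 0 < t) :
    L (t + 1) = L t + Matrix.vecMulVec (frameResidual (d t) (L t) (r t) (s t)).ofLp
      ((1 + (r t).ofLp ⬝ᵥ gain lam1 (fun i => (r i).ofLp) t *ᵥ (r t).ofLp)⁻¹ •
        gain lam1 (fun i => (r i).ofLp) t *ᵥ (r t).ofLp) := by
  obtain ⟨t, rfl⟩ := Nat.exists_eq_add_one_of_ne_zero ht.ne'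
  have h1 := basis_eq_mul_gain hlam1 (Nat.succ_pos (t + 1)) (h.basis_update (t + 1))
  have h2 := basis_eq_mul_gain hlam1 (Nat.add_one_pos t) (h.basis_update t)
  have hg := gain_succ_mulVec hlam1 (fun i => (r i).ofLp) (t + 1)
  have hv : (r (t + 1)).ofLp ᵥ* gain lam1 (fun i => (r i).ofLp) (t + 1 + 1)
      = gain lam1 (fun i => (r i).ofLp) (t + 1 + 1) *ᵥ (r (t + 1)).ofLp := by
    rw [← Matrix.vecMul_transpose, gain_isSymm]
  rw [h1, Finset.sum_range_succ, Matrix.add_mul, Matrix.vecMulVec_mul, hv, hg]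
  nth_rewrite 1 [gain_succ]
  rw [Matrix.mul_sub, ← h2, Matrix.mul_smul, Matrix.mul_vecMulVec, Matrix.mulVec_mulVec, ← h2,
    ← Matrix.vecMulVec_smul, sub_add, ← Matrix.sub_vecMulVec]
  rw [sub_eq_add_neg, ← Matrix.neg_vecMulVec]
  congr 2
  simp only [frameResidual, WithLp.ofLp_sub]
  abel

end BasisUpdate

/-! ### Conditioning on the past, a martingale law of large numbers, supermartingale convergence. -/

section Probability

variable {Ω : Type*} {mΩ : MeasurableSpace Ω} {μ : Measure Ω}

/-- Conditioning on a σ-algebra that is independent of `Y` integrates out `Y`. -/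
theorem condExp_comp_prodMk_of_indep {Ω β E : Type*} {m mΩ : MeasurableSpace Ω} {μ : Measure Ω}
    [IsProbabilityMeasure μ] [MeasurableSpace β] [MeasurableSpace E] (hm : m ≤ mΩ) {Y : Ω → E}
    (hY : Measurable Y) (hind : Indep m (MeasurableSpace.comap Y inferInstance) μ) {Z : Ω → β}
    (hZ : Measurable[m] Z) {φ : β × E → ℝ} (hφ : Measurable φ)
    (hint : Integrable (fun ω => φ (Z ω, Y ω)) μ) :
    μ[fun ω => φ (Z ω, Y ω) | m] =ᵐ[μ] fun ω => ∫ x, φ (Z ω, x) ∂(μ.map Y) := by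
  have : IsProbabilityMeasure (μ.map Y) := Measure.isProbabilityMeasure_map hY.aemeasurable
  have hψ : Measurable fun z => ∫ x, φ (z, x) ∂(μ.map Y) :=
    hφ.stronglyMeasurable.integral_prod_right'.measurable
  have hg : Measurable fun w : ℝ × β => w.1 * ∫ x, φ (w.2, x) ∂(μ.map Y) :=
    measurable_fst.mul (hψ.comp measurable_snd)
  -- Pairing the indicator of A with Z turns an integral over A into a full integral against a
  -- product law, so Fubini applies directly.
  have hlaw : ∀ A, MeasurableSet[m] A →
      Measurable (fun ω => (A.indicator (fun _ => (1 : ℝ)) ω, Z ω)) ∧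
      μ.map (fun ω => ((A.indicator (fun _ => (1 : ℝ)) ω, Z ω), Y ω))
        = (μ.map fun ω => (A.indicator (fun _ => (1 : ℝ)) ω, Z ω)).prod (μ.map Y) := by
    intro A hA
    have hW : Measurable[m] fun ω => (A.indicator (fun _ => (1 : ℝ)) ω, Z ω) :=
      (measurable_const.indicator hA).prodMk hZ
    have hW' := hW.mono hm le_rfl
    refine ⟨hW', ?_⟩
    rw [← indepFun_iff_map_prod_eq_prod_map_map hW'.aemeasurable hY.aemeasurable,
      IndepFun_iff_Indep]
    exact indep_of_indep_of_le_left hind hW.comap_le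
  have hprod : ∀ A, MeasurableSet[m] A → Integrable
      (fun u : (ℝ × β) × E => u.1.1 * φ (u.1.2, u.2))
      ((μ.map fun ω => (A.indicator (fun _ => (1 : ℝ)) ω, Z ω)).prod (μ.map Y)) := by
    intro A hA
    obtain ⟨hW, hmap⟩ := hlaw A hA
    rw [← hmap, integrable_map_measure (by fun_prop) (by fun_prop)]
    refine (hint.indicator (hm A hA)).congr (Eventually.of_forall fun ω => ?_)
    by_cases h : ω ∈ A <;> simp [h]
  have hψint : ∀ A, MeasurableSet[m] A →
      Integrable (A.indicator fun ω => ∫ x, φ (Z ω, x) ∂(μ.map Y)) μ := by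
    intro A hA
    obtain ⟨hW, hmap⟩ := hlaw A hA
    have h := (hprod A hA).integral_prod_left
    simp only [integral_const_mul] at h
    rw [integrable_map_measure hg.aestronglyMeasurable hW.aemeasurable] at h
    refine h.congr (Eventually.of_forall fun ω => ?_)
    by_cases h : ω ∈ A <;> simp [h]
  refine (ae_eq_condExp_of_forall_setIntegral_eq hm hint (fun A hA _ => ?_) (fun A hA _ => ?_)
    (hψ.comp hZ).stronglyMeasurable.aestronglyMeasurable).symm
  · exact (integrable_indicator_iff (hm A hA)).1 (hψint A hA)
  · obtain ⟨hW, hmap⟩ := hlaw A hA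
    have h := integral_prod _ (hprod A hA)
    rw [← hmap, integral_map (by fun_prop) (by fun_prop)] at h
    simp only [integral_const_mul] at h
    rw [integral_map hW.aemeasurable hg.aestronglyMeasurable] at h
    rw [← integral_indicator (hm A hA), ← integral_indicator (hm A hA)]
    convert h.symm using 2
    · funext ω
      by_cases h : ω ∈ A <;> simp [h]
    · funext ω
      by_cases h : ω ∈ A <;> simp [h]

/-- Kronecker's lemma for the weights i + 1: by Abel summation the average is the partial sum N n
minus the Cesàro mean of the N i, and these share a limit. -/
theorem tendsto_average_of_tendsto_sum_div {x : ℕ → ℝ} {l : ℝ}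
    (h : Tendsto (fun n : ℕ => ∑ i ∈ Finset.range n, x i / ((i : ℝ) + 1)) atTop (𝓝 l)) :
    Tendsto (fun n : ℕ => (n : ℝ)⁻¹ * ∑ i ∈ Finset.range n, x i) atTop (𝓝 0) := by
  set N : ℕ → ℝ := fun n => ∑ i ∈ Finset.range n, x i / ((i : ℝ) + 1) with hN
  have hS : ∀ n : ℕ, ∑ i ∈ Finset.range n, x i = n * N n - ∑ i ∈ Finset.range n, N i := by
    intro n
    induction n with
    | zero => simp
    | succ n ih =>
      have hn : (n : ℝ) + 1 ≠ 0 := by positivity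
      have hstep : N (n + 1) = N n + x n / ((n : ℝ) + 1) := Finset.sum_range_succ _ _
      rw [Finset.sum_range_succ, ih, Finset.sum_range_succ (fun i => N i), hstep]
      push_cast
      field_simp
      ring
  have hlim := h.sub h.cesaro
  rw [sub_self] at hlim
  refine hlim.congr' ?_
  filter_upwards [eventually_gt_atTop 0] with n hn
  have hn' : (n : ℝ) ≠ 0 := by exact_mod_cast hn.ne'
  rw [hS]
  field_simp

/-- The sums of ξ i / (i + 1) form a martingale with orthogonal increments. Its second moments are
bounded by C² ∑ 1/(i + 1)², so it converges almost surely, and Kronecker's lemma concludes. -/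
theorem ae_tendsto_average_martingaleDifference [IsProbabilityMeasure μ] {ℱ : Filtration ℕ mΩ}
    {ξ : ℕ → Ω → ℝ} {C : ℝ} (hmeas : ∀ n, StronglyMeasurable[ℱ (n + 1)] (ξ n))
    (hbdd : ∀ n, ∀ᵐ ω ∂μ, |ξ n ω| ≤ C) (hce : ∀ n, μ[ξ n | ℱ n] =ᵐ[μ] 0) :
    ∀ᵐ ω ∂μ, Tendsto (fun n : ℕ => (n : ℝ)⁻¹ * ∑ i ∈ Finset.range n, ξ i ω) atTop (𝓝 0) := by
  let N : ℕ → Ω → ℝ := fun n ω => ∑ i ∈ Finset.range n, ξ i ω / ((i : ℝ) + 1)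
  have hstep : ∀ n, N (n + 1) = N n + fun ω => ξ n ω / ((n : ℝ) + 1) := fun n => by
    funext ω
    exact Finset.sum_range_succ _ _
  have hNm : ∀ n, StronglyMeasurable[ℱ n] (N n) := by
    intro n
    refine Finset.stronglyMeasurable_fun_sum _ fun i hi => ?_
    have h : StronglyMeasurable[ℱ n] (ξ i) := (hmeas i).mono (ℱ.mono (Finset.mem_range.1 hi))
    exact h.measurable.div_const _ |>.stronglyMeasurable
  have hξm : ∀ n, StronglyMeasurable (ξ n) := fun n => (hmeas n).mono (ℱ.le _)
  have hNbdd : ∀ n, ∀ᵐ ω ∂μ, |N n ω| ≤ n * C := by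
    intro n
    filter_upwards [ae_all_iff.2 hbdd] with ω hω
    refine (Finset.abs_sum_le_sum_abs _ _).trans ?_
    refine (Finset.sum_le_card_nsmul _ _ C fun i _ => ?_).trans_eq (by simp)
    rw [abs_div, abs_of_pos (by positivity : (0 : ℝ) < (i : ℝ) + 1)]
    refine (div_le_self (abs_nonneg _) ?_).trans (hω i)
    linarith [(Nat.cast_nonneg i : (0 : ℝ) ≤ i)]
  have hξint : ∀ n, Integrable (ξ n) μ := fun n =>
    Integrable.of_bound (hξm n).aestronglyMeasurable C (hbdd n)
  have hNint : ∀ n, Integrable (N n) μ := fun n =>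
    Integrable.of_bound ((hNm n).mono (ℱ.le n)).aestronglyMeasurable _ (hNbdd n)
  have hξint' : ∀ n, Integrable (fun ω => ξ n ω / ((n : ℝ) + 1)) μ := fun n => (hξint n).div_const _
  have hmart : Martingale N ℱ μ := by
    refine martingale_nat hNm hNint fun n => ?_
    have h1 : μ[N (n + 1) | ℱ n] =ᵐ[μ] μ[N n | ℱ n] + μ[fun ω => ξ n ω / ((n : ℝ) + 1) | ℱ n] := by
      rw [hstep]
      exact condExp_add (hNint n) (hξint' n) _
    have h2 : μ[fun ω => ξ n ω / ((n : ℝ) + 1) | ℱ n] =ᵐ[μ] 0 := by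
      have h3 : (fun ω => ξ n ω / ((n : ℝ) + 1)) = ((n : ℝ) + 1)⁻¹ • ξ n := by
        funext ω
        simp [div_eq_inv_mul]
      rw [h3]
      filter_upwards [condExp_smul (μ := μ) ((n : ℝ) + 1)⁻¹ (ξ n) (ℱ n), hce n] with ω h4 h5
      rw [h4, Pi.smul_apply, h5]
      simp
    rw [condExp_of_stronglyMeasurable (ℱ.le n) (hNm n) (hNint n)] at h1
    filter_upwards [h1, h2] with ω h4 h5
    rw [h4, Pi.add_apply, h5]
    simp
  have horth : ∀ n, ∫ ω, N n ω * ξ n ω ∂μ = 0 := by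
    intro n
    have hint : Integrable (N n * ξ n) μ :=
      (hξint n).bdd_mul ((hNm n).mono (ℱ.le n)).aestronglyMeasurable (hNbdd n)
    have h1 := condExp_mul_of_stronglyMeasurable_left (hNm n) hint (hξint n)
    have h2 : μ[N n * ξ n | ℱ n] =ᵐ[μ] 0 := by
      filter_upwards [h1, hce n] with ω h3 h4
      rw [h3, Pi.mul_apply, h4]
      simp
    have h3 := integral_condExp (μ := μ) (f := N n * ξ n) (ℱ.le n)
    rw [integral_congr_ae h2] at h3
    simpa using h3.symm
  have hsqint : ∀ n, Integrable (fun ω => N n ω ^ 2) μ := by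
    intro n
    have := (hNint n).bdd_mul ((hNm n).mono (ℱ.le n)).aestronglyMeasurable (hNbdd n)
    simpa only [sq] using this
  have hsummable : Summable fun i : ℕ => C ^ 2 * (1 / ((i : ℝ) + 1) ^ 2) := by
    refine Summable.mul_left _ ?_
    have := (summable_nat_add_iff 1).2 (Real.summable_one_div_nat_pow.2 (by norm_num : 1 < 2))
    simpa using this
  have hsq : ∀ n, ∫ ω, N n ω ^ 2 ∂μ ≤ ∑ i ∈ Finset.range n, C ^ 2 * (1 / ((i : ℝ) + 1) ^ 2) := by
    intro n
    induction n with
    | zero => simp [N]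
    | succ n ih =>
      have hexp : ∀ᵐ ω ∂μ, N (n + 1) ω ^ 2 ≤ (N n ω ^ 2 + 2 / ((n : ℝ) + 1) * (N n ω * ξ n ω))
          + C ^ 2 * (1 / ((n : ℝ) + 1) ^ 2) := by
        filter_upwards [hbdd n] with ω hω
        rw [hstep, Pi.add_apply]
        have h1 : ξ n ω ^ 2 ≤ C ^ 2 := sq_le_sq' (neg_le_of_abs_le hω) (le_of_abs_le hω)
        have h2 : (ξ n ω / ((n : ℝ) + 1)) ^ 2 ≤ C ^ 2 * (1 / ((n : ℝ) + 1) ^ 2) := by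
          rw [div_pow, mul_one_div]
          gcongr
        have h3 : (N n ω + ξ n ω / ((n : ℝ) + 1)) ^ 2
            = N n ω ^ 2 + 2 / ((n : ℝ) + 1) * (N n ω * ξ n ω) + (ξ n ω / ((n : ℝ) + 1)) ^ 2 := by
          ring
        linarith
      have hmul : Integrable (fun ω => N n ω * ξ n ω) μ :=
        (hξint n).bdd_mul ((hNm n).mono (ℱ.le n)).aestronglyMeasurable (hNbdd n)
      have h1 := integral_mono_ae (hsqint (n + 1))
        (((hsqint n).add (hmul.const_mul _)).add (integrable_const _)) hexp
      have h2 : ∫ ω, (N n ω ^ 2 + 2 / ((n : ℝ) + 1) * (N n ω * ξ n ω))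
          + C ^ 2 * (1 / ((n : ℝ) + 1) ^ 2) ∂μ
          = ∫ ω, N n ω ^ 2 ∂μ + C ^ 2 * (1 / ((n : ℝ) + 1) ^ 2) := by
        have h3 : Integrable (fun ω => N n ω ^ 2 + 2 / ((n : ℝ) + 1) * (N n ω * ξ n ω)) μ :=
          (hsqint n).add (hmul.const_mul _)
        rw [integral_add h3 (integrable_const _),
          integral_add (hsqint n) (hmul.const_mul _), integral_const_mul, horth]
        simp
      rw [Finset.sum_range_succ]
      exact (h1.trans_eq h2).trans (by linarith)
  set B := ∑' i : ℕ, C ^ 2 * (1 / ((i : ℝ) + 1) ^ 2) with hB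
  have hR : ∀ n, eLpNorm (N n) 1 μ ≤ ((1 + B).toNNReal : ENNReal) := by
    intro n
    rw [eLpNorm_one_eq_lintegral_enorm, ← ofReal_integral_norm_eq_lintegral_enorm (hNint n)]
    refine ENNReal.ofReal_le_ofReal ?_
    -- The L² bound becomes the L¹ bound needed for Doob's theorem through |x| ≤ 1 + x².
    have h1 : ∫ ω, ‖N n ω‖ ∂μ ≤ ∫ ω, (1 + N n ω ^ 2) ∂μ := by
      refine integral_mono (hNint n).norm ((integrable_const _).add (hsqint n)) fun ω => ?_
      simp only [Real.norm_eq_abs]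
      nlinarith [sq_nonneg (|N n ω| - 1), sq_abs (N n ω)]
    rw [integral_add (integrable_const _) (hsqint n)] at h1
    have h2 := (hsq n).trans (hsummable.sum_le_tsum (Finset.range n) fun i _ => by positivity)
    simp only [integral_const, probReal_univ, smul_eq_mul, mul_one] at h1
    linarith
  filter_upwards [hmart.submartingale.exists_ae_tendsto_of_bdd hR] with ω hω
  obtain ⟨l, hl⟩ := hω
  exact tendsto_average_of_tendsto_sum_div hl

theorem ae_exists_tendsto_of_nonneg_supermartingale [IsProbabilityMeasure μ] {ℱ : Filtration ℕ mΩ}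
    {X : ℕ → Ω → ℝ} (hX : Supermartingale X ℱ μ) (h0 : ∀ n, 0 ≤ᵐ[μ] X n) {C : ℝ}
    (hC : ∀ n, ∀ᵐ ω ∂μ, X n ω ≤ C) :
    ∀ᵐ ω ∂μ, ∃ l, Tendsto (fun n => X n ω) atTop (𝓝 l) := by
  have hR : ∀ n, eLpNorm ((-X) n) 1 μ ≤ (C.toNNReal : ENNReal) := fun n => by
    refine (eLpNorm_le_of_ae_bound (C := C) ?_).trans ?_
    · filter_upwards [h0 n, hC n] with ω h1 h2
      rw [Pi.neg_apply, Pi.neg_apply, norm_neg, Real.norm_of_nonneg h1]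
      exact h2
    · simp [ENNReal.ofReal]
  filter_upwards [hX.neg.exists_ae_tendsto_of_bdd hR] with ω hω
  obtain ⟨l, hl⟩ := hω
  exact ⟨-l, by simpa using hl.neg⟩

/-- The joint law of Λ, the past and d t splits first between Λ and the frames, then between past
and present. Reassociating the triple product gives the claim. -/
theorem indepFun_history [IsProbabilityMeasure μ] {β E : Type*} [MeasurableSpace β]
    [MeasurableSpace E] {Λ : Ω → β} {d : ℕ → Ω → E} (hΛ : Measurable Λ)
    (hd : ∀ t, Measurable (d t)) (hind : iIndepFun d μ) (hΛd : IndepFun Λ (fun ω t => d t ω) μ)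
    (t : ℕ) : IndepFun (fun ω => (Λ ω, fun i : Finset.range t => d i ω)) (d t) μ := by
  have hU : Measurable fun ω => fun i : Finset.range t => d i ω :=
    measurable_pi_lambda _ fun i => hd i
  have hpast : Measurable fun (x : ℕ → E) (i : Finset.range t) => x i :=
    measurable_pi_lambda _ fun i => measurable_pi_apply _
  have hlast : Measurable fun x : ({t} : Finset ℕ) → E => x ⟨t, Finset.mem_singleton_self t⟩ :=
    measurable_pi_apply _
  have hUV : IndepFun (fun ω => fun i : Finset.range t => d i ω) (d t) μ :=
    (hind.indepFun_finset (Finset.range t) {t} (by simp) hd).comp measurable_id hlast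
  have hΛU : IndepFun Λ (fun ω => fun i : Finset.range t => d i ω) μ :=
    hΛd.comp measurable_id hpast
  have hΛUV : IndepFun Λ (fun ω => ((fun i : Finset.range t => d i ω), d t ω)) μ :=
    hΛd.comp measurable_id (hpast.prodMk (measurable_pi_apply t))
  have : IsProbabilityMeasure (μ.map Λ) := Measure.isProbabilityMeasure_map hΛ.aemeasurable
  have : IsProbabilityMeasure (μ.map fun ω => fun i : Finset.range t => d i ω) :=
    Measure.isProbabilityMeasure_map hU.aemeasurable
  have : IsProbabilityMeasure (μ.map (d t)) := Measure.isProbabilityMeasure_map (hd t).aemeasurable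
  rw [indepFun_iff_map_prod_eq_prod_map_map (by fun_prop) (by fun_prop)] at hUV hΛU hΛUV ⊢
  apply MeasurableEquiv.prodAssoc.map_measurableEquiv_injective
  rw [hΛU, Measure.prodAssoc_prod, ← hUV, ← hΛUV, Measure.map_map (by fun_prop) (by fun_prop)]
  rfl

end Probability

/-! ### Pathwise estimates: one rank-one step, and the bound on the surrogate gap. -/

section Descent

variable {p k : ℕ} {lam1 lam2 : ℝ} {𝒢 : Finset (Finset (Fin p))}

/-- The first-order term is wanted without the factor 1/a, so that it is linear in q and averages
cleanly over the new frame. Both the cost of removing 1/a and the quadratic term are of order M² ρ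
|q|²/a. -/
theorem IsSeparation.reconCost_rankOne_step_le (hlam1 : 0 < lam1) (hlam2 : 0 < lam2)
    {x : EuclideanSpace ℝ (Fin p)} {L : Matrix (Fin p) (Fin k) ℝ}
    {rx r : EuclideanSpace ℝ (Fin k)} {sx e : EuclideanSpace ℝ (Fin p)} {M ρ a : ℝ}
    {q : Fin k → ℝ} (hx : IsSeparation lam1 lam2 𝒢 x L rx sx)
    (hex : ‖frameResidual x L rx sx‖ ≤ M) (hrx : ‖rx‖ ^ 2 ≤ ρ) (he : ‖e‖ ≤ M) (hr : ‖r‖ ^ 2 ≤ ρ)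
    (ha : a = 1 + r.ofLp ⬝ᵥ q) (ha1 : 1 ≤ a) :
    reconCost lam1 lam2 𝒢 x (L + Matrix.vecMulVec e.ofLp (a⁻¹ • q)) ≤ reconCost lam1 lam2 𝒢 x L
      - inner ℝ (frameResidual x L rx sx) e * (rx.ofLp ⬝ᵥ q)
      + 2 * (M ^ 2 * ρ) * (a⁻¹ * (q ⬝ᵥ q)) := by
  have h := hx.reconCost_add_basis_le hlam1 hlam2 (Matrix.vecMulVec e.ofLp (a⁻¹ • q))
  set ex := frameResidual x L rx sx
  have ha0 : 0 < a := by linarith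
  have hM : 0 ≤ M := (norm_nonneg _).trans he
  have hρ : 0 ≤ ρ := (sq_nonneg _).trans hr
  have hq0 : 0 ≤ q ⬝ᵥ q := Finset.sum_nonneg fun _ _ => mul_self_nonneg _
  have hin : inner ℝ ex (WithLp.toLp 2 (Matrix.vecMulVec e.ofLp (a⁻¹ • q) *ᵥ rx.ofLp))
      = a⁻¹ * (inner ℝ ex e * (rx.ofLp ⬝ᵥ q)) := by
    rw [Matrix.vecMulVec_mulVec, op_smul_eq_smul, WithLp.toLp_smul, inner_smul_right,
      smul_dotProduct, dotProduct_comm q, smul_eq_mul]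
    ring
  have hfrob : frobSq (Matrix.vecMulVec e.ofLp (a⁻¹ • q)) = a⁻¹ * (a⁻¹ * (‖e‖ ^ 2 * (q ⬝ᵥ q))) := by
    rw [EuclideanSpace.real_norm_sq_eq, dotProduct, Finset.sum_mul_sum, frobSq]
    simp only [Finset.mul_sum]
    refine Finset.sum_congr rfl fun i _ => Finset.sum_congr rfl fun j _ => ?_
    rw [Matrix.vecMulVec_apply, Pi.smul_apply, smul_eq_mul]
    ring
  have hcs : ∀ y : EuclideanSpace ℝ (Fin k), ‖y‖ ^ 2 ≤ ρ → (y.ofLp ⬝ᵥ q) ^ 2 ≤ ρ * (q ⬝ᵥ q) := by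
    intro y hy
    refine (Finset.sum_mul_sq_le_sq_mul_sq _ _ _).trans ?_
    rw [← EuclideanSpace.real_norm_sq_eq]
    simp only [dotProduct, ← sq]
    exact mul_le_mul_of_nonneg_right hy (Finset.sum_nonneg fun _ _ => sq_nonneg _)
  have hexe : |inner ℝ ex e| ≤ M ^ 2 := by
    refine (abs_real_inner_le_norm ex e).trans ?_
    rw [sq]
    exact mul_le_mul hex he (norm_nonneg _) hM
  have hcross : inner ℝ ex e * (rx.ofLp ⬝ᵥ q) * (r.ofLp ⬝ᵥ q) ≤ M ^ 2 * (ρ * (q ⬝ᵥ q)) := by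
    have h1 : |(rx.ofLp ⬝ᵥ q) * (r.ofLp ⬝ᵥ q)| ≤ ρ * (q ⬝ᵥ q) := by
      have := hcs rx hrx
      have := hcs r hr
      rw [abs_le]
      constructor
      · nlinarith [sq_nonneg (rx.ofLp ⬝ᵥ q + r.ofLp ⬝ᵥ q)]
      · nlinarith [sq_nonneg (rx.ofLp ⬝ᵥ q - r.ofLp ⬝ᵥ q)]
    refine (le_abs_self _).trans ?_
    rw [mul_assoc, abs_mul]
    exact mul_le_mul hexe h1 (abs_nonneg _) (sq_nonneg _)
  -- This is 1/a = 1 - (r·q)/a; the correction contains a second factor of q, so Cauchy–Schwarz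
  -- makes it second order.
  have hid : a⁻¹ * (inner ℝ ex e * (rx.ofLp ⬝ᵥ q)) = inner ℝ ex e * (rx.ofLp ⬝ᵥ q)
      - a⁻¹ * (inner ℝ ex e * (rx.ofLp ⬝ᵥ q) * (r.ofLp ⬝ᵥ q)) := by
    have : r.ofLp ⬝ᵥ q = a - 1 := by linarith
    rw [this]
    field_simp
    ring
  have hai : a⁻¹ ≤ 1 := inv_le_one_of_one_le₀ ha1
  have hai0 : 0 ≤ a⁻¹ := inv_nonneg.2 ha0.le
  have h1 := mul_le_mul_of_nonneg_left hcross hai0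
  have he2 : ‖e‖ ^ 2 ≤ M ^ 2 := pow_le_pow_left₀ (norm_nonneg _) he 2
  have h2 : ‖rx‖ ^ 2 * frobSq (Matrix.vecMulVec e.ofLp (a⁻¹ • q))
      ≤ ρ * (a⁻¹ * (M ^ 2 * (q ⬝ᵥ q))) := by
    rw [hfrob]
    refine mul_le_mul hrx ?_ (by positivity) hρ
    refine mul_le_mul_of_nonneg_left ?_ hai0
    refine (mul_le_of_le_one_left (by positivity) hai).trans ?_
    exact mul_le_mul_of_nonneg_right he2 hq0
  have h3 : 0 ≤ ρ * (a⁻¹ * (M ^ 2 * (q ⬝ᵥ q))) := by positivity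
  rw [hin, hid] at h
  nlinarith

/-- Follow-the-leader: L (t + 1) is compared with L t, for which the newly added term is exactly the
reconstruction cost of d t. -/
theorem IsOLSDRun.sum_frameObj_add_le {d : ℕ → EuclideanSpace ℝ (Fin p)}
    (hlam1 : 0 < lam1) (hlam2 : 0 < lam2)
    {L : ℕ → Matrix (Fin p) (Fin k) ℝ} {r : ℕ → EuclideanSpace ℝ (Fin k)}
    {s : ℕ → EuclideanSpace ℝ (Fin p)} (h : IsOLSDRun lam1 lam2 𝒢 d L r s) (t : ℕ) :
    ∑ i ∈ Finset.range t, frameObj lam1 lam2 𝒢 (d i) (L t) (r i) (s i) + lam1 / 2 * frobSq (L t)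
      ≤ lam1 / 2 * frobSq (L 0) + ∑ i ∈ Finset.range t, reconCost lam1 lam2 𝒢 (d i) (L i) := by
  induction t with
  | zero => simp
  | succ t ih =>
    have hpos : (0 : ℝ) < ((t + 1 : ℕ) : ℝ) := by positivity
    have hscale : ∀ x y : ℝ, 1 / ((t + 1 : ℕ) : ℝ) * x + lam1 / (2 * ((t + 1 : ℕ) : ℝ)) * y
        = 1 / ((t + 1 : ℕ) : ℝ) * (x + lam1 / 2 * y) := fun x y => by field_simp
    have h1 := h.basis_update t (L t)
    unfold surrogateCost at h1
    rw [hscale, hscale] at h1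
    have h2 := le_of_mul_le_mul_left h1 (by positivity)
    refine h2.trans ?_
    have hsep : IsSeparation lam1 lam2 𝒢 (d t) (L t) (r t) (s t) := h.separation t
    rw [Finset.sum_range_succ, Finset.sum_range_succ, hsep.reconCost_eq hlam1 hlam2]
    linarith

theorem IsOLSDRun.gap_bounds {d : ℕ → EuclideanSpace ℝ (Fin p)}
    (hlam1 : 0 < lam1) (hlam2 : 0 < lam2)
    {L : ℕ → Matrix (Fin p) (Fin k) ℝ} {r : ℕ → EuclideanSpace ℝ (Fin k)}
    {s : ℕ → EuclideanSpace ℝ (Fin p)} (h : IsOLSDRun lam1 lam2 𝒢 d L r s) (t : ℕ) :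
    0 ≤ surrogateCost lam1 lam2 𝒢 d r s t (L t) - empiricalCost lam1 lam2 𝒢 d t (L t) ∧
    surrogateCost lam1 lam2 𝒢 d r s t (L t) - empiricalCost lam1 lam2 𝒢 d t (L t) ≤
      (t : ℝ)⁻¹ * (lam1 / 2 * frobSq (L 0))
        + (t : ℝ)⁻¹ * ∑ i ∈ Finset.range t, reconCost lam1 lam2 𝒢 (d i) (L i)
        - (t : ℝ)⁻¹ * ∑ i ∈ Finset.range t, reconCost lam1 lam2 𝒢 (d i) (L t) := by
  have ht : 0 ≤ (t : ℝ)⁻¹ := by positivity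
  have heq : surrogateCost lam1 lam2 𝒢 d r s t (L t) - empiricalCost lam1 lam2 𝒢 d t (L t)
      = (t : ℝ)⁻¹ * (∑ i ∈ Finset.range t, frameObj lam1 lam2 𝒢 (d i) (L t) (r i) (s i)
        - ∑ i ∈ Finset.range t, reconCost lam1 lam2 𝒢 (d i) (L t)) := by
    unfold surrogateCost empiricalCost
    rw [one_div]
    ring
  rw [heq]
  constructor
  · exact mul_nonneg ht (sub_nonneg.2 (Finset.sum_le_sum fun i _ =>
      reconCost_le_frameObj hlam1 hlam2 _ _ _ _))
  · rw [← mul_add, ← mul_sub]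
    refine mul_le_mul_of_nonneg_left ?_ ht
    have h1 := h.sum_frameObj_add_le hlam1 hlam2 t
    have h2 : 0 ≤ lam1 / 2 * frobSq (L t) := mul_nonneg (by positivity) (frobSq_nonneg _)
    linarith

end Descent

/-! ### Measurability of the separation, the reconstruction cost and the gain. -/

section MeasurableSeparation

variable {p k : ℕ} {lam1 lam2 : ℝ} {𝒢 : Finset (Finset (Fin p))}

/-- Uniqueness makes any choice of separation the only one, hence measurable. -/
theorem exists_measurable_separation (hlam1 : 0 < lam1) (hlam2 : 0 < lam2)
    (𝒢 : Finset (Finset (Fin p))) :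
    ∃ σ : EuclideanSpace ℝ (Fin p) × Matrix (Fin p) (Fin k) ℝ →
        EuclideanSpace ℝ (Fin k) × EuclideanSpace ℝ (Fin p),
      Measurable σ ∧ ∀ x L, IsSeparation lam1 lam2 𝒢 x L (σ (x, L)).1 (σ (x, L)).2 := by
  choose σ hσ using fun z : EuclideanSpace ℝ (Fin p) × Matrix (Fin p) (Fin k) ℝ =>
    exists_isSeparation hlam1 hlam2 𝒢 z.1 z.2
  have hF := continuous_frameObj (p := p) (k := k) lam1 lam2 𝒢
  refine ⟨σ, measurable_of_unique_minimizer
    (F := fun z y => frameObj lam1 lam2 𝒢 z.1 z.2 y.1 y.2) (fun y => ?_) (fun z => ?_)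
    (fun z y => ?_) (fun z y hy => ?_), fun x L => ?_⟩
  · have h := hF.comp (Continuous.prodMk_left y)
    simpa only [Function.comp_def] using h.measurable
  · exact continuous_frameObj_right lam1 lam2 𝒢 z.1 z.2
  · exact hσ z y.1 y.2
  · have h := IsSeparation.unique hlam1 hlam2 (fun r' s' => hy (r', s')) (hσ z)
    exact Prod.ext h.1 h.2
  · have h := hσ (x, L)
    simpa only using h

theorem measurable_frameResidual :
    Measurable fun z : (EuclideanSpace ℝ (Fin p) × Matrix (Fin p) (Fin k) ℝ) ×
      (EuclideanSpace ℝ (Fin k) × EuclideanSpace ℝ (Fin p)) =>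
        frameResidual z.1.1 z.1.2 z.2.1 z.2.2 :=
  continuous_frameResidual.measurable

theorem measurable_reconCost (hlam1 : 0 < lam1) (hlam2 : 0 < lam2)
    (𝒢 : Finset (Finset (Fin p))) :
    Measurable fun z : EuclideanSpace ℝ (Fin p) × Matrix (Fin p) (Fin k) ℝ =>
      reconCost lam1 lam2 𝒢 z.1 z.2 := by
  obtain ⟨σ, hσm, hσ⟩ := exists_measurable_separation (k := k) hlam1 hlam2 𝒢
  have h : (fun z : EuclideanSpace ℝ (Fin p) × Matrix (Fin p) (Fin k) ℝ =>
      reconCost lam1 lam2 𝒢 z.1 z.2) = fun z => frameObj lam1 lam2 𝒢 z.1 z.2 (σ z).1 (σ z).2 := by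
    funext z
    exact (hσ z.1 z.2).reconCost_eq hlam1 hlam2
  rw [h]
  have := (continuous_frameObj (p := p) (k := k) lam1 lam2 𝒢).measurable.comp
    (measurable_id.prodMk hσm)
  simpa only [Function.comp_def, id] using this

theorem Measurable.reconCost {X : Type*} [MeasurableSpace X] (hlam1 : 0 < lam1) (hlam2 : 0 < lam2)
    (𝒢 : Finset (Finset (Fin p))) {f : X → EuclideanSpace ℝ (Fin p)}
    {g : X → Matrix (Fin p) (Fin k) ℝ} (hf : Measurable f) (hg : Measurable g) :
    Measurable fun x => _root_.reconCost lam1 lam2 𝒢 (f x) (g x) := by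
  have h := (measurable_reconCost (k := k) hlam1 hlam2 𝒢).comp (hf.prodMk hg)
  simpa only [Function.comp_def] using h

theorem measurable_gain {X : Type*} [MeasurableSpace X] (lam : ℝ) {r : ℕ → X → Fin k → ℝ} (t : ℕ)
    (h : ∀ i < t, Measurable (r i)) : Measurable fun x => gain lam (fun i => r i x) t := by
  induction t with
  | zero => exact measurable_const
  | succ t ih =>
    have hP := ih fun i hi => h i (hi.trans t.lt_succ_self)
    have hr := h t t.lt_succ_self
    have hPij : ∀ i j, Measurable fun x => gain lam (fun i => r i x) t i j := fun i j =>
      (Matrix.measurable_entry i j).comp hP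
    have hri : ∀ i, Measurable fun x => r t x i := fun i => (measurable_pi_apply i).comp hr
    have hq : ∀ i, Measurable fun x => (gain lam (fun i => r i x) t *ᵥ r t x) i := fun i => by
      simp only [Matrix.mulVec, dotProduct]
      exact Finset.measurable_fun_sum _ fun j _ => (hPij i j).mul (hri j)
    have hrq : Measurable fun x => r t x ⬝ᵥ gain lam (fun i => r i x) t *ᵥ r t x :=
      Finset.measurable_fun_sum _ fun j _ => (hri j).mul (hq j)
    refine Matrix.measurable_of_entries fun i j => ?_
    simp only [gain_succ, Matrix.sub_apply, Matrix.smul_apply, Matrix.vecMulVec_apply, smul_eq_mul]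
    exact (hPij i j).sub ((measurable_const.add hrq).inv.mul ((hq i).mul (hq j)))

end MeasurableSeparation

/-! ### The expected cost and the uniform law of large numbers. -/

section ExpectedCost

variable {p k : ℕ} {lam1 lam2 : ℝ} {𝒢 : Finset (Finset (Fin p))}

/-- The expected reconstruction cost of a frame with law `ν`. -/
noncomputable def expectedCost (lam1 lam2 : ℝ) (𝒢 : Finset (Finset (Fin p)))
    (ν : Measure (EuclideanSpace ℝ (Fin p))) (L : Matrix (Fin p) (Fin k) ℝ) : ℝ :=
  ∫ x, reconCost lam1 lam2 𝒢 x L ∂ν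

theorem abs_reconCost_le (hlam1 : 0 < lam1) (hlam2 : 0 < lam2) {x : EuclideanSpace ℝ (Fin p)}
    {M : ℝ} (hx : ‖x‖ ≤ M) (L : Matrix (Fin p) (Fin k) ℝ) :
    |reconCost lam1 lam2 𝒢 x L| ≤ M ^ 2 := by
  rw [abs_of_nonneg (reconCost_nonneg hlam1 hlam2 x L)]
  have h1 := reconCost_le (𝒢 := 𝒢) hlam1 hlam2 x L
  have h2 := pow_le_pow_left₀ (norm_nonneg x) hx 2
  nlinarith [sq_nonneg ‖x‖]

theorem integrable_reconCost (hlam1 : 0 < lam1) (hlam2 : 0 < lam2)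
    {ν : Measure (EuclideanSpace ℝ (Fin p))} [IsProbabilityMeasure ν] {M : ℝ}
    (hν : ∀ᵐ x ∂ν, ‖x‖ ≤ M) (L : Matrix (Fin p) (Fin k) ℝ) :
    Integrable (fun x => reconCost lam1 lam2 𝒢 x L) ν := by
  have hm : Measurable fun x : EuclideanSpace ℝ (Fin p) => reconCost lam1 lam2 𝒢 x L :=
    measurable_id.reconCost hlam1 hlam2 𝒢 measurable_const
  refine Integrable.of_bound hm.aestronglyMeasurable (M ^ 2) ?_
  filter_upwards [hν] with x hx using abs_reconCost_le hlam1 hlam2 hx L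

theorem expectedCost_nonneg (hlam1 : 0 < lam1) (hlam2 : 0 < lam2)
    (ν : Measure (EuclideanSpace ℝ (Fin p))) (L : Matrix (Fin p) (Fin k) ℝ) :
    0 ≤ expectedCost lam1 lam2 𝒢 ν L :=
  integral_nonneg fun x => reconCost_nonneg hlam1 hlam2 x L

theorem expectedCost_le (hlam1 : 0 < lam1) (hlam2 : 0 < lam2)
    {ν : Measure (EuclideanSpace ℝ (Fin p))} [IsProbabilityMeasure ν] {M : ℝ}
    (hν : ∀ᵐ x ∂ν, ‖x‖ ≤ M) (L : Matrix (Fin p) (Fin k) ℝ) :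
    expectedCost lam1 lam2 𝒢 ν L ≤ M ^ 2 := by
  have h := integral_mono_ae (integrable_reconCost (𝒢 := 𝒢) hlam1 hlam2 hν L)
    (integrable_const (M ^ 2)) (by
      filter_upwards [hν] with x hx
      exact (le_abs_self _).trans (abs_reconCost_le hlam1 hlam2 hx L))
  simpa [expectedCost] using h

theorem measurable_expectedCost (hlam1 : 0 < lam1) (hlam2 : 0 < lam2)
    (𝒢 : Finset (Finset (Fin p))) (ν : Measure (EuclideanSpace ℝ (Fin p)))
    [IsProbabilityMeasure ν] :
    Measurable fun L : Matrix (Fin p) (Fin k) ℝ => expectedCost lam1 lam2 𝒢 ν L := by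
  have h : Measurable fun u : Matrix (Fin p) (Fin k) ℝ × EuclideanSpace ℝ (Fin p) =>
      reconCost lam1 lam2 𝒢 u.2 u.1 :=
    measurable_snd.reconCost hlam1 hlam2 𝒢 measurable_fst
  exact h.stronglyMeasurable.integral_prod_right'.measurable

/-- The uniform law of large numbers for the reconstruction costs. -/
theorem ae_tendsto_average_reconCost_sub {Ω : Type*} [MeasurableSpace Ω] {μ : Measure Ω}
    [IsProbabilityMeasure μ] (hlam1 : 0 < lam1) (hlam2 : 0 < lam2)
    {d : ℕ → Ω → EuclideanSpace ℝ (Fin p)} (hd : ∀ t, Measurable (d t)) (hind : iIndepFun d μ)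
    (hident : ∀ t, IdentDistrib (d t) (d 0) μ μ) {M : ℝ} (hM : ∀ᵐ ω ∂μ, ‖d 0 ω‖ ≤ M) :
    ∀ᵐ ω ∂μ, ∀ Λ : ℕ → Matrix (Fin p) (Fin k) ℝ, Tendsto (fun n : ℕ =>
      (n : ℝ)⁻¹ * ∑ i ∈ Finset.range n, reconCost lam1 lam2 𝒢 (d i ω) (Λ n)
        - expectedCost lam1 lam2 𝒢 (μ.map (d 0)) (Λ n)) atTop (𝓝 0) := by
  let B := BoundedContinuousFunction (Matrix (Fin p) (Fin k) ℝ) ℝ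
  -- The costs of a frame at all bases form one vector in the Banach space of bounded continuous
  -- functions, and the strong law there is uniform in L. The space is not separable in general; `H`
  -- is strongly measurable since it is continuous on a separable domain.
  let H : EuclideanSpace ℝ (Fin p) → B := fun x =>
    BoundedContinuousFunction.ofNormedAddCommGroup (fun L => reconCost lam1 lam2 𝒢 x L)
      (continuous_reconCost_basis hlam1 hlam2 𝒢 x) (‖x‖ ^ 2)
      (fun L => abs_reconCost_le hlam1 hlam2 le_rfl L)
  have hHnorm : ∀ x, ‖H x‖ ≤ ‖x‖ ^ 2 := fun x =>
    BoundedContinuousFunction.norm_ofNormedAddCommGroup_le _ (sq_nonneg _) _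
  have hHc : Continuous H := by
    refine continuous_iff_continuousAt.2 fun x => tendsto_iff_dist_tendsto_zero.2 ?_
    have hc : Continuous fun y : EuclideanSpace ℝ (Fin p) => (‖x‖ + 2 * ‖y - x‖) * ‖y - x‖ := by
      fun_prop
    refine squeeze_zero (fun _ => dist_nonneg) (fun y => ?_) (by simpa using hc.tendsto x)
    refine (BoundedContinuousFunction.dist_le (by positivity)).2 fun L => ?_
    have h := abs_reconCost_add_frame_sub_le (𝒢 := 𝒢) hlam1 hlam2 x (y - x) L
    rw [add_sub_cancel] at h
    exact h
  let _ : MeasurableSpace B := borel B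
  have : BorelSpace B := ⟨rfl⟩
  have hHm : Measurable H := hHc.measurable
  have hint : Integrable (fun ω => H (d 0 ω)) μ := by
    refine Integrable.of_bound (hHc.stronglyMeasurable.comp_measurable (hd 0)).aestronglyMeasurable
      (M ^ 2) ?_
    filter_upwards [hM] with ω hω
    exact (hHnorm _).trans (pow_le_pow_left₀ (norm_nonneg _) hω 2)
  have hlln := strong_law_ae (μ := μ) (fun i ω => H (d i ω)) hint
    (fun i j hij => (hind.indepFun hij).comp hHm hHm) (fun i => (hident i).comp hHm)
  filter_upwards [hlln] with ω hω Λ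
  have hdist := tendsto_iff_dist_tendsto_zero.1 hω
  refine squeeze_zero_norm (fun n => ?_) hdist
  have hev := BoundedContinuousFunction.dist_coe_le_dist
    (f := (n : ℝ)⁻¹ • ∑ i ∈ Finset.range n, H (d i ω)) (g := ∫ ω', H (d 0 ω') ∂μ) (Λ n)
  have hmean : (∫ ω', H (d 0 ω') ∂μ) (Λ n) = expectedCost lam1 lam2 𝒢 (μ.map (d 0)) (Λ n) := by
    have h1 := (BoundedContinuousFunction.evalCLM ℝ (Λ n) :
      BoundedContinuousFunction (Matrix (Fin p) (Fin k) ℝ) ℝ →L[ℝ] ℝ).integral_comp_comm hint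
    have hm : Measurable fun x : EuclideanSpace ℝ (Fin p) => reconCost lam1 lam2 𝒢 x (Λ n) :=
      measurable_id.reconCost hlam1 hlam2 𝒢 measurable_const
    rw [expectedCost, integral_map (hd 0).aemeasurable hm.aestronglyMeasurable]
    exact h1.symm
  rw [hmean] at hev
  refine le_trans (le_of_eq ?_) hev
  rw [Real.dist_eq, Real.norm_eq_abs]
  congr 2
  have hsum := map_sum (BoundedContinuousFunction.evalCLM ℝ (Λ n) :
    BoundedContinuousFunction (Matrix (Fin p) (Fin k) ℝ) ℝ →L[ℝ] ℝ)
    (fun i => H (d i ω)) (Finset.range n)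
  exact congrArg ((n : ℝ)⁻¹ * ·) hsum.symm

end ExpectedCost

/-! ### Expected decrease of the cost in one basis update. -/

section NegGrad

variable {p k : ℕ} {lam1 lam2 : ℝ} {𝒢 : Finset (Finset (Fin p))}

/-- The entries of the negative gradient `(d - L r - s) rᵀ` of the reconstruction cost in the basis,
for the separation map `σ`. -/
noncomputable def negGrad (σ : EuclideanSpace ℝ (Fin p) × Matrix (Fin p) (Fin k) ℝ →
    EuclideanSpace ℝ (Fin k) × EuclideanSpace ℝ (Fin p)) (i : Fin p) (j : Fin k)
    (u : Matrix (Fin p) (Fin k) ℝ × EuclideanSpace ℝ (Fin p)) : ℝ :=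
  frameResidual u.2 u.1 (σ (u.2, u.1)).1 (σ (u.2, u.1)).2 i * (σ (u.2, u.1)).1 j

variable {σ : EuclideanSpace ℝ (Fin p) × Matrix (Fin p) (Fin k) ℝ →
    EuclideanSpace ℝ (Fin k) × EuclideanSpace ℝ (Fin p)}

theorem measurable_negGrad (hσm : Measurable σ) (i : Fin p) (j : Fin k) :
    Measurable (negGrad σ i j) := by
  have hswap : Measurable fun u : Matrix (Fin p) (Fin k) ℝ × EuclideanSpace ℝ (Fin p) =>
      (u.2, u.1) := measurable_snd.prodMk measurable_fst
  have hσ' : Measurable fun u : Matrix (Fin p) (Fin k) ℝ × EuclideanSpace ℝ (Fin p) =>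
      σ (u.2, u.1) := hσm.comp hswap
  have hr := measurable_frameResidual.comp (hswap.prodMk hσ')
  have h1 : Measurable fun x : EuclideanSpace ℝ (Fin p) => x i := by fun_prop
  have h2 : Measurable fun x : EuclideanSpace ℝ (Fin k) => x j := by fun_prop
  exact (h1.comp hr).mul (h2.comp (measurable_fst.comp hσ'))

theorem abs_negGrad_le (hlam1 : 0 < lam1) (hlam2 : 0 < lam2)
    (hσ : ∀ x L, IsSeparation lam1 lam2 𝒢 x L (σ (x, L)).1 (σ (x, L)).2) {M : ℝ}
    {L : Matrix (Fin p) (Fin k) ℝ} {x : EuclideanSpace ℝ (Fin p)} (hx : ‖x‖ ≤ M)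
    (i : Fin p) (j : Fin k) : |negGrad σ i j (L, x)| ≤ M * (M ^ 2 / lam1 + 1) := by
  have hM : 0 ≤ M := (norm_nonneg _).trans hx
  have h1 := ((PiLp.norm_apply_le _ i).trans ((hσ x L).norm_frameResidual_le hlam1 hlam2)).trans hx
  have h2 := PiLp.norm_apply_le (σ (x, L)).1 j
  have h3 := (hσ x L).norm_sq_le hlam1 hlam2
  have h4 : ‖x‖ ^ 2 / lam1 ≤ M ^ 2 / lam1 := by gcongr
  have h5 : ‖(σ (x, L)).1‖ ≤ M ^ 2 / lam1 + 1 := by nlinarith [sq_nonneg (‖(σ (x, L)).1‖ - 1)]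
  simp only [negGrad]
  rw [abs_mul]
  exact mul_le_mul h1 (h2.trans h5) (abs_nonneg _) hM

theorem integrable_negGrad (hlam1 : 0 < lam1) (hlam2 : 0 < lam2) (hσm : Measurable σ)
    (hσ : ∀ x L, IsSeparation lam1 lam2 𝒢 x L (σ (x, L)).1 (σ (x, L)).2)
    {ν : Measure (EuclideanSpace ℝ (Fin p))} [IsProbabilityMeasure ν] {M : ℝ}
    (hν : ∀ᵐ x ∂ν, ‖x‖ ≤ M) (L : Matrix (Fin p) (Fin k) ℝ) (i : Fin p) (j : Fin k) :
    Integrable (fun x => negGrad σ i j (L, x)) ν := by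
  have hm : Measurable fun x => negGrad σ i j (L, x) :=
    (measurable_negGrad hσm i j).comp (measurable_const.prodMk measurable_id)
  refine Integrable.of_bound hm.aestronglyMeasurable (M * (M ^ 2 / lam1 + 1)) ?_
  filter_upwards [hν] with x hx using abs_negGrad_le hlam1 hlam2 hσ hx i j

/-- The decrease `⟨E Γ, Γ P⟩` of the expected cost in first order, for the basis `L`, the gain `P`
and the negative gradient `Γ` at the next frame. -/
noncomputable def firstOrderDecrease (σ : EuclideanSpace ℝ (Fin p) × Matrix (Fin p) (Fin k) ℝ →
    EuclideanSpace ℝ (Fin k) × EuclideanSpace ℝ (Fin p)) (ν : Measure (EuclideanSpace ℝ (Fin p)))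
    (u : (Matrix (Fin p) (Fin k) ℝ × Matrix (Fin k) (Fin k) ℝ) × EuclideanSpace ℝ (Fin p)) : ℝ :=
  ∑ i, ∑ j, ∑ l, (∫ x, negGrad σ i j (u.1.1, x) ∂ν) * u.1.2 j l * negGrad σ i l (u.1.1, u.2)

theorem measurable_firstOrderDecrease (hσm : Measurable σ)
    (ν : Measure (EuclideanSpace ℝ (Fin p))) [IsProbabilityMeasure ν] :
    Measurable (firstOrderDecrease σ ν) := by
  refine Finset.measurable_fun_sum _ fun i _ => Finset.measurable_fun_sum _ fun j _ =>
    Finset.measurable_fun_sum _ fun l _ => ?_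
  have h1 : Measurable fun L => ∫ x, negGrad σ i j (L, x) ∂ν :=
    (measurable_negGrad hσm i j).stronglyMeasurable.integral_prod_right'.measurable
  refine ((h1.comp (measurable_fst.comp measurable_fst)).mul ?_).mul ?_
  · exact (Matrix.measurable_entry j l).comp (measurable_snd.comp measurable_fst)
  · exact (measurable_negGrad hσm i l).comp
      ((measurable_fst.comp measurable_fst).prodMk measurable_snd)

theorem abs_firstOrderDecrease_le (hlam1 : 0 < lam1) (hlam2 : 0 < lam2)
    (hσ : ∀ x L, IsSeparation lam1 lam2 𝒢 x L (σ (x, L)).1 (σ (x, L)).2)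
    {ν : Measure (EuclideanSpace ℝ (Fin p))} [IsProbabilityMeasure ν] {M c : ℝ}
    (hν : ∀ᵐ x ∂ν, ‖x‖ ≤ M) {L : Matrix (Fin p) (Fin k) ℝ} {P : Matrix (Fin k) (Fin k) ℝ}
    (hP : ∀ i j, |P i j| ≤ c) {y : EuclideanSpace ℝ (Fin p)} (hy : ‖y‖ ≤ M) :
    |firstOrderDecrease σ ν ((L, P), y)|
      ≤ ∑ _i : Fin p, ∑ _j : Fin k, ∑ _l : Fin k,
        M * (M ^ 2 / lam1 + 1) * c * (M * (M ^ 2 / lam1 + 1)) := by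
  have hM : 0 ≤ M := (norm_nonneg _).trans hy
  have hK : 0 ≤ M * (M ^ 2 / lam1 + 1) := by positivity
  refine (Finset.abs_sum_le_sum_abs _ _).trans (Finset.sum_le_sum fun i _ => ?_)
  refine (Finset.abs_sum_le_sum_abs _ _).trans (Finset.sum_le_sum fun j _ => ?_)
  refine (Finset.abs_sum_le_sum_abs _ _).trans (Finset.sum_le_sum fun l _ => ?_)
  rw [abs_mul, abs_mul]
  have h1 : |∫ x, negGrad σ i j (L, x) ∂ν| ≤ M * (M ^ 2 / lam1 + 1) := by
    have := norm_integral_le_of_norm_le_const (μ := ν) (f := fun x => negGrad σ i j (L, x))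
      (C := M * (M ^ 2 / lam1 + 1))
      (by filter_upwards [hν] with x hx using abs_negGrad_le hlam1 hlam2 hσ hx i j)
    simpa using this
  have hc : 0 ≤ c := (abs_nonneg _).trans (hP j l)
  exact mul_le_mul (mul_le_mul h1 (hP j l) (abs_nonneg _) hK)
    (abs_negGrad_le hlam1 hlam2 hσ hy i l) (abs_nonneg _) (by positivity)

/-- Averaging over the new frame turns the second factor Γ into E Γ as well, leaving the quadratic
form of P at each row of E Γ. -/
theorem integral_firstOrderDecrease_nonneg (hlam1 : 0 < lam1) (hlam2 : 0 < lam2)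
    (hσm : Measurable σ) (hσ : ∀ x L, IsSeparation lam1 lam2 𝒢 x L (σ (x, L)).1 (σ (x, L)).2)
    {ν : Measure (EuclideanSpace ℝ (Fin p))} [IsProbabilityMeasure ν] {M : ℝ}
    (hν : ∀ᵐ x ∂ν, ‖x‖ ≤ M) (L : Matrix (Fin p) (Fin k) ℝ) {P : Matrix (Fin k) (Fin k) ℝ}
    (hP : ∀ x, 0 ≤ x ⬝ᵥ P *ᵥ x) : 0 ≤ ∫ y, firstOrderDecrease σ ν ((L, P), y) ∂ν := by
  have hint := integrable_negGrad (M := M) hlam1 hlam2 hσm hσ hν L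
  have h : ∫ y, firstOrderDecrease σ ν ((L, P), y) ∂ν
      = ∑ i, (fun j => ∫ x, negGrad σ i j (L, x) ∂ν) ⬝ᵥ
        P *ᵥ fun j => ∫ x, negGrad σ i j (L, x) ∂ν := by
    simp only [firstOrderDecrease]
    rw [integral_finsetSum _ fun i _ => integrable_finsetSum _ fun j _ =>
      integrable_finsetSum _ fun l _ => (hint i l).const_mul _]
    refine Finset.sum_congr rfl fun i _ => ?_
    rw [integral_finsetSum _ fun j _ =>
      integrable_finsetSum _ fun l _ => (hint i l).const_mul _]
    refine Finset.sum_congr rfl fun j _ => ?_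
    rw [integral_finsetSum _ fun l _ => (hint i l).const_mul _, Matrix.mulVec, dotProduct,
      Finset.mul_sum]
    refine Finset.sum_congr rfl fun l _ => ?_
    rw [integral_const_mul]
    ring
  rw [h]
  exact Finset.sum_nonneg fun i _ => hP _

theorem expectedCost_step_le (hlam1 : 0 < lam1) (hlam2 : 0 < lam2)
    (hσm : Measurable σ) (hσ : ∀ x L, IsSeparation lam1 lam2 𝒢 x L (σ (x, L)).1 (σ (x, L)).2)
    {ν : Measure (EuclideanSpace ℝ (Fin p))} [IsProbabilityMeasure ν] {M : ℝ}
    (hν : ∀ᵐ x ∂ν, ‖x‖ ≤ M) {L : Matrix (Fin p) (Fin k) ℝ} {P : Matrix (Fin k) (Fin k) ℝ}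
    (hP : ∀ x, 0 ≤ x ⬝ᵥ P *ᵥ x) {y : EuclideanSpace ℝ (Fin p)} (hy : ‖y‖ ≤ M)
    {r : EuclideanSpace ℝ (Fin k)} {s : EuclideanSpace ℝ (Fin p)} (hrs : (r, s) = σ (y, L)) :
    expectedCost lam1 lam2 𝒢 ν (L + Matrix.vecMulVec (frameResidual y L r s).ofLp
        ((1 + r.ofLp ⬝ᵥ P *ᵥ r.ofLp)⁻¹ • P *ᵥ r.ofLp))
      ≤ expectedCost lam1 lam2 𝒢 ν L - firstOrderDecrease σ ν ((L, P), y)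
        + 2 * (M ^ 2 * (M ^ 2 / lam1)) * ((1 + r.ofLp ⬝ᵥ P *ᵥ r.ofLp)⁻¹ *
          ((P *ᵥ r.ofLp) ⬝ᵥ (P *ᵥ r.ofLp))) := by
  set q := P *ᵥ r.ofLp with hq
  set a := 1 + r.ofLp ⬝ᵥ q with ha
  have ha1 : 1 ≤ a := by have := hP r.ofLp; linarith
  have hsep : IsSeparation lam1 lam2 𝒢 y L r s := by
    have := hσ y L
    rwa [← hrs] at this
  have hsq : ∀ z : EuclideanSpace ℝ (Fin p), ‖z‖ ≤ M → ‖z‖ ^ 2 / lam1 ≤ M ^ 2 / lam1 :=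
    fun z hz => by gcongr
  set e := frameResidual y L r s with he
  have hexp : ∀ x, inner ℝ (frameResidual x L (σ (x, L)).1 (σ (x, L)).2) e
      * ((σ (x, L)).1.ofLp ⬝ᵥ q) = ∑ i, ∑ j, negGrad σ i j (L, x) * (e i * q j) := by
    intro x
    rw [PiLp.inner_apply, dotProduct, Finset.sum_mul_sum]
    refine Finset.sum_congr rfl fun i _ => Finset.sum_congr rfl fun j _ => ?_
    simp only [negGrad, RCLike.inner_apply, conj_trivial]
    ring
  have hint := integrable_negGrad (M := M) hlam1 hlam2 hσm hσ hν L
  have hI : Integrable (fun x => ∑ i, ∑ j, negGrad σ i j (L, x) * (e i * q j)) ν :=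
    integrable_finsetSum _ fun i _ => integrable_finsetSum _ fun j _ => (hint i j).mul_const _
  -- As q = P r, the products e i * q j expand into entries of P times entries of the negative
  -- gradient e rᵀ at the new frame y.
  have hfo : ∫ x, ∑ i, ∑ j, negGrad σ i j (L, x) * (e i * q j) ∂ν
      = firstOrderDecrease σ ν ((L, P), y) := by
    rw [integral_finsetSum _ fun i _ => integrable_finsetSum _ fun j _ => (hint i j).mul_const _]
    refine Finset.sum_congr rfl fun i _ => ?_
    rw [integral_finsetSum _ fun j _ => (hint i j).mul_const _]
    refine Finset.sum_congr rfl fun j _ => ?_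
    rw [integral_mul_const, hq, Matrix.mulVec, dotProduct, Finset.mul_sum, Finset.mul_sum]
    refine Finset.sum_congr rfl fun l _ => ?_
    simp only [negGrad, ← hrs]
    ring
  have hcost := integrable_reconCost (𝒢 := 𝒢) hlam1 hlam2 hν L
  have hmono := integral_mono_ae
    (integrable_reconCost (𝒢 := 𝒢) hlam1 hlam2 hν (L + Matrix.vecMulVec e.ofLp (a⁻¹ • q)))
    ((hcost.sub hI).add (integrable_const (2 * (M ^ 2 * (M ^ 2 / lam1)) * (a⁻¹ * (q ⬝ᵥ q))))) (by
      filter_upwards [hν] with x hx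
      have h := (hσ x L).reconCost_rankOne_step_le hlam1 hlam2 (e := e) (r := r) (a := a) (q := q)
        (((hσ x L).norm_frameResidual_le hlam1 hlam2).trans hx)
        (((hσ x L).norm_sq_le hlam1 hlam2).trans (hsq x hx))
        ((hsep.norm_frameResidual_le hlam1 hlam2).trans hy)
        ((hsep.norm_sq_le hlam1 hlam2).trans (hsq y hy)) ha ha1
      rw [hexp] at h
      exact h)
  refine hmono.trans_eq ?_
  have h1 : ∫ x, ((fun x => reconCost lam1 lam2 𝒢 x L)
      - fun x => ∑ i, ∑ j, negGrad σ i j (L, x) * (e i * q j)) x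
      + 2 * (M ^ 2 * (M ^ 2 / lam1)) * (a⁻¹ * (q ⬝ᵥ q)) ∂ν
      = expectedCost lam1 lam2 𝒢 ν L - firstOrderDecrease σ ν ((L, P), y)
        + 2 * (M ^ 2 * (M ^ 2 / lam1)) * (a⁻¹ * (q ⬝ᵥ q)) := by
    rw [integral_add (hcost.sub hI) (integrable_const _), ← hfo, expectedCost]
    simp only [Pi.sub_apply]
    rw [integral_sub hcost hI]
    simp
  exact h1

end NegGrad

/-! ### Adaptedness of the iterates and almost sure limits along a run. -/

section Run

variable {Ω : Type*} {mΩ : MeasurableSpace Ω} {p k : ℕ} {lam1 lam2 : ℝ}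
  {𝒢 : Finset (Finset (Fin p))} {d : ℕ → Ω → EuclideanSpace ℝ (Fin p)}
  {L : ℕ → Ω → Matrix (Fin p) (Fin k) ℝ} {r : ℕ → Ω → EuclideanSpace ℝ (Fin k)}
  {s : ℕ → Ω → EuclideanSpace ℝ (Fin p)}
  {σ : EuclideanSpace ℝ (Fin p) × Matrix (Fin p) (Fin k) ℝ →
    EuclideanSpace ℝ (Fin k) × EuclideanSpace ℝ (Fin p)}

theorem IsOLSDRun.eq_separation {d : ℕ → EuclideanSpace ℝ (Fin p)}
    (hlam1 : 0 < lam1) (hlam2 : 0 < lam2)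
    {L : ℕ → Matrix (Fin p) (Fin k) ℝ} {r : ℕ → EuclideanSpace ℝ (Fin k)}
    {s : ℕ → EuclideanSpace ℝ (Fin p)} (h : IsOLSDRun lam1 lam2 𝒢 d L r s)
    (hσ : ∀ x L, IsSeparation lam1 lam2 𝒢 x L (σ (x, L)).1 (σ (x, L)).2) (t : ℕ) :
    (r t, s t) = σ (d t, L t) := by
  have h1 : IsSeparation lam1 lam2 𝒢 (d t) (L t) (r t) (s t) := h.separation t
  have h2 := h1.unique hlam1 hlam2 (hσ (d t) (L t))
  exact Prod.ext h2.1 h2.2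

/-- The iterates of O-LSD are adapted to every filtration to which the initial basis and the frames
are adapted. -/
theorem measurable_iterates (hlam1 : 0 < lam1) (hlam2 : 0 < lam2) (ℱ : Filtration ℕ mΩ)
    (hσm : Measurable σ) (hσ : ∀ x L, IsSeparation lam1 lam2 𝒢 x L (σ (x, L)).1 (σ (x, L)).2)
    (hL0 : Measurable[ℱ 0] (L 0)) (hd : ∀ t, Measurable[ℱ (t + 1)] (d t))
    (hrun : ∀ ω, IsOLSDRun lam1 lam2 𝒢 (fun t => d t ω) (fun t => L t ω) (fun t => r t ω)
      (fun t => s t ω)) (t : ℕ) :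
    Measurable[ℱ t] (L t) ∧ ∀ i < t, Measurable[ℱ t] (r i) ∧ Measurable[ℱ t] (s i) := by
  induction t with
  | zero => exact ⟨hL0, fun i hi => absurd hi (Nat.not_lt_zero i)⟩
  | succ t ih =>
    obtain ⟨hL, hrs⟩ := ih
    have hle : ℱ t ≤ ℱ (t + 1) := ℱ.mono t.le_succ
    have hsep : Measurable[ℱ (t + 1)] fun ω => σ (d t ω, L t ω) :=
      hσm.comp ((hd t).prodMk (hL.mono hle le_rfl))
    have hrt : r t = fun ω => (σ (d t ω, L t ω)).1 := by
      funext ω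
      rw [← (hrun ω).eq_separation hlam1 hlam2 hσ t]
    have hst : s t = fun ω => (σ (d t ω, L t ω)).2 := by
      funext ω
      rw [← (hrun ω).eq_separation hlam1 hlam2 hσ t]
    have hrs' : ∀ i < t + 1, Measurable[ℱ (t + 1)] (r i) ∧ Measurable[ℱ (t + 1)] (s i) := by
      intro i hi
      rcases Nat.lt_succ_iff_lt_or_eq.1 hi with hi | rfl
      · exact ⟨(hrs i hi).1.mono hle le_rfl, (hrs i hi).2.mono hle le_rfl⟩
      · rw [hrt, hst]
        exact ⟨measurable_fst.comp hsep, measurable_snd.comp hsep⟩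
    refine ⟨?_, hrs'⟩
    have hLeq : L (t + 1) = fun ω => (∑ i ∈ Finset.range (t + 1),
        Matrix.vecMulVec (d i ω - s i ω).ofLp (r i ω).ofLp)
        * gain lam1 (fun i => (r i ω).ofLp) (t + 1) := by
      funext ω
      exact basis_eq_mul_gain hlam1 (Nat.succ_pos t) ((hrun ω).basis_update t)
    have hp : ∀ a : Fin p, Measurable fun x : EuclideanSpace ℝ (Fin p) => x a := fun a => by fun_prop
    have hk : ∀ b : Fin k, Measurable fun x : EuclideanSpace ℝ (Fin k) => x b := fun b => by fun_prop
    have hkk : Measurable fun x : EuclideanSpace ℝ (Fin k) => x.ofLp := by fun_prop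
    have hgain : Measurable[ℱ (t + 1)] fun ω => gain lam1 (fun i => (r i ω).ofLp) (t + 1) :=
      @measurable_gain k Ω (ℱ (t + 1)) lam1 (fun i ω => (r i ω).ofLp) (t + 1)
        fun i hi => hkk.comp (hrs' i hi).1
    rw [hLeq]
    refine @Matrix.measurable_of_entries _ _ Ω (ℱ (t + 1)) _ fun a b => ?_
    simp only [Matrix.mul_apply, Matrix.sum_apply, Matrix.vecMulVec_apply, WithLp.ofLp_sub,
      Pi.sub_apply]
    refine Finset.measurable_fun_sum _ fun j _ => Measurable.mul
      (Finset.measurable_fun_sum _ fun i hi => ?_) ((Matrix.measurable_entry j b).comp hgain)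
    have hi' := Finset.mem_range.1 hi
    have hdi : Measurable[ℱ (t + 1)] (d i) := (hd i).mono (ℱ.mono hi') le_rfl
    exact (((hp a).comp hdi).sub ((hp a).comp (hrs' i hi').2)).mul ((hk j).comp (hrs' i hi').1)

variable {μ : Measure Ω} [IsProbabilityMeasure μ]

/-- The trace of the gain serves as a compensator: its decrease pays for the second-order error of
each update, so no step-size estimate is required. -/
theorem ae_exists_tendsto_expectedCost (hlam1 : 0 < lam1) (hlam2 : 0 < lam2) (ℱ : Filtration ℕ mΩ)
    (hσm : Measurable σ) (hσ : ∀ x L, IsSeparation lam1 lam2 𝒢 x L (σ (x, L)).1 (σ (x, L)).2)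
    (hL0 : Measurable[ℱ 0] (L 0)) (hd : ∀ t, Measurable[ℱ (t + 1)] (d t))
    (hrun : ∀ ω, IsOLSDRun lam1 lam2 𝒢 (fun t => d t ω) (fun t => L t ω) (fun t => r t ω)
      (fun t => s t ω))
    (hind : ∀ t, Indep (ℱ t) (MeasurableSpace.comap (d t) inferInstance) μ)
    {ν : Measure (EuclideanSpace ℝ (Fin p))} [IsProbabilityMeasure ν]
    (hlaw : ∀ t, μ.map (d t) = ν) {M : ℝ} (hν : ∀ᵐ x ∂ν, ‖x‖ ≤ M)
    (hM : ∀ t, ∀ᵐ ω ∂μ, ‖d t ω‖ ≤ M) :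
    ∀ᵐ ω ∂μ, ∃ l, Tendsto (fun t => expectedCost lam1 lam2 𝒢 ν (L t ω)) atTop (𝓝 l) := by
  have hit := measurable_iterates hlam1 hlam2 ℱ hσm hσ hL0 hd hrun
  let P : ℕ → Ω → Matrix (Fin k) (Fin k) ℝ := fun t ω => gain lam1 (fun i => (r i ω).ofLp) t
  let c := 2 * (M ^ 2 * (M ^ 2 / lam1))
  have hc : 0 ≤ c := by positivity
  have hkk : Measurable fun x : EuclideanSpace ℝ (Fin k) => x.ofLp := by fun_prop
  have hPm : ∀ t, Measurable[ℱ t] (P t) := fun t =>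
    @measurable_gain k Ω (ℱ t) lam1 (fun i ω => (r i ω).ofLp) t
      fun i hi => hkk.comp ((hit t).2 i hi).1
  have htr : Measurable fun A : Matrix (Fin k) (Fin k) ℝ => A.trace :=
    Finset.measurable_fun_sum _ fun i _ => Matrix.measurable_entry i i
  -- The index starts at 1: the ridge penalty is centred at 0, so L 1 is not a recursive least
  -- squares step from L 0. The filtration is shifted accordingly.
  let X : ℕ → Ω → ℝ := fun t ω =>
    expectedCost lam1 lam2 𝒢 ν (L (t + 1) ω) + c * (P (t + 1) ω).trace
  have hXm : ∀ t, Measurable[ℱ (t + 1)] (X t) := fun t =>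
    ((measurable_expectedCost hlam1 hlam2 𝒢 ν).comp (hit (t + 1)).1).add
      ((htr.comp (hPm (t + 1))).const_mul c)
  have hX0 : ∀ t ω, 0 ≤ X t ω := fun t ω =>
    add_nonneg (expectedCost_nonneg hlam1 hlam2 ν _)
      (mul_nonneg hc (trace_gain_nonneg hlam1 _ _))
  have hXC : ∀ t ω, X t ω ≤ M ^ 2 + c * (k * lam1⁻¹) := fun t ω =>
    add_le_add (expectedCost_le hlam1 hlam2 hν _)
      (mul_le_mul_of_nonneg_left (trace_gain_le hlam1 _ _) hc)
  have hXint : ∀ t, Integrable (X t) μ := fun t =>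
    Integrable.of_bound ((hXm t).mono (ℱ.le _) le_rfl).aestronglyMeasurable
      (M ^ 2 + c * (k * lam1⁻¹)) (Eventually.of_forall fun ω => by
        rw [Real.norm_of_nonneg (hX0 t ω)]
        exact hXC t ω)
  let 𝒜 : Filtration ℕ mΩ := ⟨fun t => ℱ (t + 1), fun _ _ h => ℱ.mono (Nat.succ_le_succ h),
    fun t => ℱ.le (t + 1)⟩
  let D : ℕ → Ω → ℝ := fun t ω =>
    firstOrderDecrease σ ν ((L (t + 1) ω, P (t + 1) ω), d (t + 1) ω)
  have hZm : ∀ t, Measurable[ℱ (t + 1)] fun ω => (L (t + 1) ω, P (t + 1) ω) := fun t =>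
    (hit (t + 1)).1.prodMk (hPm (t + 1))
  have hdm : ∀ t, Measurable (d t) := fun t => (hd t).mono (ℱ.le _) le_rfl
  have hDint : ∀ t, Integrable (D t) μ := fun t => by
    refine Integrable.of_bound ((measurable_firstOrderDecrease hσm ν).comp
      (((hZm t).mono (ℱ.le _) le_rfl).prodMk (hdm (t + 1)))).aestronglyMeasurable
      (∑ _i : Fin p, ∑ _j : Fin k, ∑ _l : Fin k,
        M * (M ^ 2 / lam1 + 1) * lam1⁻¹ * (M * (M ^ 2 / lam1 + 1))) ?_
    filter_upwards [hM (t + 1)] with ω hω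
    exact abs_firstOrderDecrease_le hlam1 hlam2 hσ hν (abs_gain_apply_le hlam1 _ _) hω
  have hstep : ∀ t, ∀ᵐ ω ∂μ, X (t + 1) ω ≤ (X t - D t) ω := by
    intro t
    filter_upwards [hM (t + 1)] with ω hω
    have h1 := expectedCost_step_le hlam1 hlam2 hσm hσ hν (L := L (t + 1) ω) (P := P (t + 1) ω)
      (dotProduct_gain_nonneg hlam1 _ _) hω ((hrun ω).eq_separation hlam1 hlam2 hσ (t + 1))
    have h2 := (hrun ω).basis_succ hlam1 (Nat.succ_pos t)
    have h3 := trace_gain_succ lam1 (fun i => (r i ω).ofLp) (t + 1)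
    simp only [P] at h1
    rw [Nat.succ_eq_add_one] at h2
    simp only [X, D, P, Pi.sub_apply]
    rw [h2, h3]
    simp only [c]
    linarith
  have hsuper : Supermartingale X 𝒜 μ := by
    refine supermartingale_nat (fun t => (hXm t).stronglyMeasurable) hXint fun t => ?_
    have h1 : μ[X (t + 1) | 𝒜 t] ≤ᵐ[μ] μ[X t - D t | 𝒜 t] :=
      condExp_mono (hXint (t + 1)) ((hXint t).sub (hDint t)) (hstep t)
    have h2 := condExp_sub (hXint t) (hDint t) (𝒜 t)
    have h3 : μ[X t | 𝒜 t] = X t :=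
      condExp_of_stronglyMeasurable (𝒜.le t) (hXm t).stronglyMeasurable (hXint t)
    have h4 := condExp_comp_prodMk_of_indep (ℱ.le (t + 1)) (hdm (t + 1)) (hind (t + 1)) (hZm t)
      (measurable_firstOrderDecrease hσm ν) (hDint t)
    rw [h3] at h2
    filter_upwards [h1, h2, h4] with ω h1 h2 h4
    have h5 := integral_firstOrderDecrease_nonneg hlam1 hlam2 hσm hσ hν (L (t + 1) ω)
      (P := P (t + 1) ω) (dotProduct_gain_nonneg hlam1 _ _)
    rw [hlaw] at h4
    refine h1.trans ?_
    rw [h2, Pi.sub_apply]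
    have h6 : μ[D t | 𝒜 t] ω = ∫ y, firstOrderDecrease σ ν ((L (t + 1) ω, P (t + 1) ω), y) ∂ν := h4
    rw [h6]
    linarith
  have hconv := ae_exists_tendsto_of_nonneg_supermartingale hsuper
    (fun t => Eventually.of_forall (hX0 t)) (fun t => Eventually.of_forall (hXC t))
  filter_upwards [hconv] with ω hω
  obtain ⟨l, hl⟩ := hω
  -- The trace part decreases and is bounded below, so its limit can be subtracted from that of `X`.
  have hanti : Antitone fun t => c * (P t ω).trace := by
    refine antitone_nat_of_succ_le fun t => mul_le_mul_of_nonneg_left ?_ hc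
    have h1 := trace_gain_succ lam1 (fun i => (r i ω).ofLp) t
    have h2 := dotProduct_gain_nonneg hlam1 (fun i => (r i ω).ofLp) t (r t ω).ofLp
    have h3 : 0 ≤ (gain lam1 (fun i => (r i ω).ofLp) t *ᵥ (r t ω).ofLp) ⬝ᵥ
      (gain lam1 (fun i => (r i ω).ofLp) t *ᵥ (r t ω).ofLp) :=
      Finset.sum_nonneg fun _ _ => mul_self_nonneg _
    have h4 := mul_nonneg (inv_nonneg.2 (by linarith : 0 ≤ 1 + (r t ω).ofLp ⬝ᵥ
      gain lam1 (fun i => (r i ω).ofLp) t *ᵥ (r t ω).ofLp)) h3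
    simp only [P]
    linarith
  have hbelow : BddBelow (Set.range fun t => c * (P t ω).trace) := by
    refine ⟨0, ?_⟩
    rintro _ ⟨t, rfl⟩
    exact mul_nonneg hc (trace_gain_nonneg hlam1 _ _)
  have hP := tendsto_atTop_ciInf hanti hbelow
  refine ⟨l - ⨅ t, c * (P t ω).trace, ?_⟩
  rw [← tendsto_add_atTop_iff_nat 1]
  refine (hl.sub ((tendsto_add_atTop_iff_nat 1).2 hP)).congr fun t => ?_
  simp only [X]
  ring

/-- Given the past, L i is fixed and d i is fresh, so the conditional mean of its cost is the
expected cost at L i: the terms are bounded martingale differences. -/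
theorem ae_tendsto_average_reconCost_sub_expectedCost (hlam1 : 0 < lam1) (hlam2 : 0 < lam2)
    (ℱ : Filtration ℕ mΩ) (hL : ∀ t, Measurable[ℱ t] (L t))
    (hd : ∀ t, Measurable[ℱ (t + 1)] (d t))
    (hind : ∀ t, Indep (ℱ t) (MeasurableSpace.comap (d t) inferInstance) μ)
    {ν : Measure (EuclideanSpace ℝ (Fin p))} [IsProbabilityMeasure ν]
    (hlaw : ∀ t, μ.map (d t) = ν) {M : ℝ} (hν : ∀ᵐ x ∂ν, ‖x‖ ≤ M)
    (hM : ∀ t, ∀ᵐ ω ∂μ, ‖d t ω‖ ≤ M) :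
    ∀ᵐ ω ∂μ, Tendsto (fun n : ℕ => (n : ℝ)⁻¹ * ∑ i ∈ Finset.range n,
      (reconCost lam1 lam2 𝒢 (d i ω) (L i ω) - expectedCost lam1 lam2 𝒢 ν (L i ω)))
      atTop (𝓝 0) := by
  have hcost : ∀ t, Measurable[ℱ (t + 1)] fun ω => reconCost lam1 lam2 𝒢 (d t ω) (L t ω) :=
    fun t => @Measurable.reconCost p k lam1 lam2 Ω (ℱ (t + 1)) hlam1 hlam2 𝒢 _ _ (hd t)
      ((hL t).mono (ℱ.mono t.le_succ) le_rfl)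
  have hexp : ∀ t, Measurable[ℱ t] fun ω => expectedCost lam1 lam2 𝒢 ν (L t ω) := fun t =>
    (measurable_expectedCost hlam1 hlam2 𝒢 ν).comp (hL t)
  have hexpb : ∀ t ω, |expectedCost lam1 lam2 𝒢 ν (L t ω)| ≤ M ^ 2 := fun t ω => by
    rw [abs_of_nonneg (expectedCost_nonneg hlam1 hlam2 ν _)]
    exact expectedCost_le hlam1 hlam2 hν _
  have hcostb : ∀ t, ∀ᵐ ω ∂μ, |reconCost lam1 lam2 𝒢 (d t ω) (L t ω)| ≤ M ^ 2 := fun t => by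
    filter_upwards [hM t] with ω hω using abs_reconCost_le hlam1 hlam2 hω _
  have hcosti : ∀ t, Integrable (fun ω => reconCost lam1 lam2 𝒢 (d t ω) (L t ω)) μ := fun t =>
    Integrable.of_bound ((hcost t).mono (ℱ.le _) le_rfl).aestronglyMeasurable _ (hcostb t)
  have hexpi : ∀ t, Integrable (fun ω => expectedCost lam1 lam2 𝒢 ν (L t ω)) μ := fun t =>
    Integrable.of_bound ((hexp t).mono (ℱ.le _) le_rfl).aestronglyMeasurable _
      (Eventually.of_forall (hexpb t))
  refine ae_tendsto_average_martingaleDifference (ℱ := ℱ) (C := M ^ 2 + M ^ 2) (fun t => ?_)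
    (fun t => ?_) fun t => ?_
  · exact ((hcost t).sub ((hexp t).mono (ℱ.mono t.le_succ) le_rfl)).stronglyMeasurable
  · filter_upwards [hcostb t] with ω hω
    exact (abs_sub _ _).trans (add_le_add hω (hexpb t ω))
  · have h1 := condExp_sub (hcosti t) (hexpi t) (ℱ t)
    have h2 : μ[fun ω => expectedCost lam1 lam2 𝒢 ν (L t ω) | ℱ t]
        = fun ω => expectedCost lam1 lam2 𝒢 ν (L t ω) :=
      condExp_of_stronglyMeasurable (ℱ.le t) (hexp t).stronglyMeasurable (hexpi t)
    have h3 := condExp_comp_prodMk_of_indep (ℱ.le t) ((hd t).mono (ℱ.le _) le_rfl) (hind t) (hL t)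
      (φ := fun u => reconCost lam1 lam2 𝒢 u.2 u.1)
      (measurable_snd.reconCost hlam1 hlam2 𝒢 measurable_fst) (hcosti t)
    rw [h2] at h1
    rw [hlaw] at h3
    filter_upwards [h1, h3] with ω h1 h3
    refine h1.trans ?_
    rw [Pi.sub_apply, h3]
    exact sub_self _

end Run

/-! ### Assembly of the three almost sure limits. -/

theorem theorem3 {Ω : Type*} [MeasurableSpace Ω] (μ : Measure Ω) [IsProbabilityMeasure μ]
    (p k : ℕ) (lam1 lam2 : ℝ) (hlam1 : 0 < lam1) (hlam2 : 0 < lam2)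
    (𝒢 : Finset (Finset (Fin p)))
    (d : ℕ → Ω → EuclideanSpace ℝ (Fin p))
    (L : ℕ → Ω → Matrix (Fin p) (Fin k) ℝ)
    (r : ℕ → Ω → EuclideanSpace ℝ (Fin k))
    (s : ℕ → Ω → EuclideanSpace ℝ (Fin p))
    -- the frames are independent, identically distributed and uniformly bounded
    (hd_meas : ∀ t, Measurable (d t))
    (hd_indep : iIndepFun d μ)
    (hd_ident : ∀ t, IdentDistrib (d t) (d 0) μ μ)
    (hd_bdd : ∃ M : ℝ, ∀ t, ∀ᵐ ω ∂μ, ‖d t ω‖ ≤ M)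
    -- the initial basis may be random, independently of the frames
    (hL0_meas : ∀ i j, Measurable (fun ω => L 0 ω i j))
    (hL0_indep : IndepFun (fun ω (ij : Fin p × Fin k) => L 0 ω ij.1 ij.2) (fun ω t => d t ω) μ)
    -- the basis, coefficients and foregrounds are produced by O-LSD
    (hrun : ∀ ω, IsOLSDRun lam1 lam2 𝒢 (fun t => d t ω) (fun t => L t ω)
      (fun t => r t ω) (fun t => s t ω)) :
    ∀ᵐ ω ∂μ, Tendsto
      (fun t : ℕ =>
        surrogateCost lam1 lam2 𝒢 (fun i => d i ω) (fun i => r i ω) (fun i => s i ω) t (L t ω)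
          - empiricalCost lam1 lam2 𝒢 (fun i => d i ω) t (L t ω))
      atTop (𝓝 0) := by
  obtain ⟨M, hM⟩ := hd_bdd
  obtain ⟨σ, hσm, hσ⟩ := exists_measurable_separation (k := k) hlam1 hlam2 𝒢
  let Λ : Ω → Fin p × Fin k → ℝ := fun ω ij => L 0 ω ij.1 ij.2
  have hΛ : Measurable Λ := measurable_pi_lambda _ fun ij => hL0_meas ij.1 ij.2
  let H : (t : ℕ) → Ω → (Fin p × Fin k → ℝ) × (Finset.range t → EuclideanSpace ℝ (Fin p)) :=
    fun t ω => (Λ ω, fun i => d i ω)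
  have hH : ∀ t, Measurable (H t) := fun t =>
    hΛ.prodMk (measurable_pi_lambda _ fun i => hd_meas i)
  -- The information before frame t: the initial basis and frames 0, …, t - 1. Thus L t is known at
  -- time t while d t is still independent of it.
  let ℱ : Filtration ℕ (inferInstance : MeasurableSpace Ω) :=
    { seq := fun t => MeasurableSpace.comap (H t) inferInstance
      mono' := fun t u htu => by
        have hproj : Measurable fun z : (Fin p × Fin k → ℝ) ×
            (Finset.range u → EuclideanSpace ℝ (Fin p)) =>
            (z.1, fun i : Finset.range t => z.2 ⟨i, Finset.range_mono htu i.2⟩) :=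
          measurable_fst.prodMk (measurable_pi_lambda _ fun i =>
            (measurable_pi_apply _).comp measurable_snd)
        have h := hproj.comp (comap_measurable (H u))
        exact h.comap_le
      le' := fun t => (hH t).comap_le }
  have hFL0 : Measurable[ℱ 0] (L 0) := by
    refine @Matrix.measurable_of_entries _ _ Ω (ℱ 0) _ fun i j => ?_
    exact ((measurable_pi_apply (i, j)).comp measurable_fst).comp (comap_measurable (H 0))
  have hFd : ∀ t, Measurable[ℱ (t + 1)] (d t) := fun t =>
    ((measurable_pi_apply (⟨t, Finset.self_mem_range_succ t⟩ : Finset.range (t + 1))).comp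
      measurable_snd).comp (comap_measurable (H (t + 1)))
  have hind : ∀ t, Indep (ℱ t) (MeasurableSpace.comap (d t) inferInstance) μ := fun t =>
    (IndepFun_iff_Indep _ _ _).1 (indepFun_history hΛ hd_meas hd_indep hL0_indep t)
  have : IsProbabilityMeasure (μ.map (d 0)) :=
    Measure.isProbabilityMeasure_map (hd_meas 0).aemeasurable
  have hlaw : ∀ t, μ.map (d t) = μ.map (d 0) := fun t => (hd_ident t).map_eq
  have hν : ∀ᵐ x ∂(μ.map (d 0)), ‖x‖ ≤ M :=
    (ae_map_iff (hd_meas 0).aemeasurable (measurableSet_le measurable_norm measurable_const)).2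
      (hM 0)
  have hit := measurable_iterates hlam1 hlam2 ℱ hσm hσ hFL0 hFd hrun
  filter_upwards [ae_exists_tendsto_expectedCost hlam1 hlam2 ℱ hσm hσ hFL0 hFd hrun hind hlaw hν hM,
    ae_tendsto_average_reconCost_sub_expectedCost (𝒢 := 𝒢) hlam1 hlam2 ℱ (fun t => (hit t).1) hFd
      hind hlaw hν hM,
    ae_tendsto_average_reconCost_sub (k := k) (𝒢 := 𝒢) hlam1 hlam2 hd_meas hd_indep hd_ident (hM 0)]
    with ω ⟨l, hl⟩ hmart hulln
  have hbound := fun t => (hrun ω).gap_bounds hlam1 hlam2 t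
  refine squeeze_zero (fun t => (hbound t).1) (fun t => (hbound t).2) ?_
  have h0 : Tendsto (fun t : ℕ => (t : ℝ)⁻¹ * (lam1 / 2 * frobSq (L 0 ω))) atTop (𝓝 0) := by
    simpa using tendsto_natCast_atTop_atTop.inv_tendsto_atTop.mul_const
      (lam1 / 2 * frobSq (L 0 ω))
  -- The null set of the uniform law does not depend on the sequence of bases, so it may be applied
  -- to the random L t. The Cesàro limit l of the expected costs cancels against the limit of the
  -- current one.
  have hsum := (((h0.add hmart).add hl.cesaro).sub (hulln fun t => L t ω)).sub hl
  rw [add_zero, zero_add, sub_zero, sub_self] at hsum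
  refine hsum.congr fun t => ?_
  rw [Finset.sum_sub_distrib]
  ring
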